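/- **Setting.** Work on $\mathbb R^3$. Let $a$ run over an index set for a basis of the Lie algebra of the gauge group, $\mu\in\{1,2,3\}$, let $\alpha$ be a multi-index of partial derivatives, and let $m\in\mathbb C$ be arbitrary (the Chern–Simons mass). The *gaussian BFYM model* has the fields $A^a_\mu,B^a_\mu,c^a$ and the external sources $\Omega^a_{A\mu},\Omega^a_{B\mu},\Omega^a_c$ (with $\Omega_A$ standing for the combination of the source of $A$ with the gradient of the antighost), of ghost numbers $0,0,1,-1,-1,-2$. The *extended BFYM model* has in addition the fields $\eta^a,\varphi^a$ and the sources $\Omega^a_\eta,\Omega^a_\varphi$, of ghost numbers $0,1,-1,-2$. (Here too $\Omega_A,\Omega_B$ are the combinations with the gradients of the antighosts.) Grassmann parity is ghost number modulo $2$. For each model let $\mathcal L$ be the free graded-commutative complex algebra on the jet variables $\partial_\alpha f$, where $f$ runs over the components of the fields and sources. Local $q$-forms are the forms $\sum_{\mu_1<\dots<\mu_q}\omega_{\mu_1\dots\mu_q}\,dx^{\mu_1}\wedge\dots\wedge dx^{\mu_q}$ with $\omega_{\mu_1\dots\mu_q}\in\mathcal L$; $\Omega^p_q$ is the space of those whose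 components all have ghost number $p$. The linear part $b_0$ of the (linearized) Slavnov–Taylor operator is the odd antiderivation of $\mathcal L$ commuting with the derivatives $\partial_\mu$ and given on the fields and sources as follows, where $d^\dagger=*d*$, so that $d^\dagger V=\sum_\mu\partial_\mu V_\mu$ on one-forms. In the gaussian model $$b_0A=-dc,\quad b_0B=0,\quad b_0c=0,\quad b_0\Omega_A=i*dB+im*dA,\quad b_0\Omega_B=i*dA+2B,\quad b_0\Omega_c=d^\dagger\Omega_A .$$ In the extended model $$b_0A=-dc,\quad b_0B=-d\varphi,\quad b_0\eta=\varphi,\quad b_0c=b_0\varphi=0,\quad b_0\Omega_A=i*dB+im*dA,$$ $$b_0\Omega_B=i*dA+2(B+d\eta),\quad b_0\Omega_\eta=-2\,d^\dagger(B+d\eta),\quad b_0\Omega_c=-d^\dagger\Omega_A,\quad b_0\Omega_\varphi=-d^\dagger\Omega_B-\Omega_\eta .$$ These equations hold component by component, and $b_0$ acts on local forms through their components. One has $b_0^2=0$. The local cohomology of $b_0$ is $H^p_q=\{\omega\in\Omega^p_q: b_0\omega=0\}\,/\,b_0\Omega^{p-1}_q$, for $p\in\mathbb Z$ and $q\ge0$.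 Let $\mathcal D\subset\mathcal L$ be the subalgebra generated by * the components $\partial_\mu A^a_\nu-\partial_\nu A^a_\mu$ of $dA$ and all their derivatives, * the undifferentiated ghosts $c^a$, * the $B^a_\mu$ and all their derivatives. **Proposition 3.1.** The local cohomology of $b_0$ is independent of the external sources and depends only on $dA$ and its derivatives, on $c$ not derived, and on $B$ and its derivatives. That is: 1. In the gaussian model every element of $\mathcal D$ is $b_0$-closed, and for all $p,q$ every class in $H^p_q$ is represented by a cocycle in $\Omega^p_q$ all of whose components lie in $\mathcal D$. 2. In the extended model, for all $p,q$, every class in $H^p_q$ is represented by a cocycle in $\Omega^p_q$ all of whose components lie in $\mathcal D$. In particular the cohomology depends neither on the external sources nor on $\eta,\varphi$. -/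

import Mathlib

namespace BFYM

/-! ### Free graded-commutative algebras with a linear odd differential -/

/-- A type `X` of graded variables together with a linear differential of degree `1` on them. -/
structure LinearModel (X : Type*) where
  /-- The ghost number of a variable; its class modulo `2` is the Grassmann parity. -/
  gh : X → ℤ
  /-- The image of a variable under the differential, a linear combination of variables. -/
  op : X → (X →₀ ℂ)
  op_mem : ∀ x, op x ∈ Finsupp.supported ℂ ℂ {y | gh y = gh x + 1}
  op_op : ∀ x, Finsupp.linearCombination ℂ op (op x) = 0

namespace LinearModel

variable {X : Type*} (M : LinearModel X)

/-- The sign `(-1) ^ n` as a complex number. -/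
def sgn (n : ℤ) : ℂ := ((n.negOnePow : ℤ) : ℂ)

/-- Graded commutativity of the variables: `x y = (-1) ^ (gh x * gh y) y x`.
In particular `x * x = 0` when `x` is odd. -/
inductive Rel : FreeAlgebra ℂ X → FreeAlgebra ℂ X → Prop
  | swap (x y : X) : Rel (FreeAlgebra.ι ℂ x * FreeAlgebra.ι ℂ y)
      (sgn (M.gh x * M.gh y) • (FreeAlgebra.ι ℂ y * FreeAlgebra.ι ℂ x))

/-- The polynomials in the variables: the free graded-commutative complex algebra on `X`. -/
def Alg : Type _ := RingQuot M.Rel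

noncomputable instance : Ring M.Alg := inferInstanceAs (Ring (RingQuot M.Rel))

noncomputable instance : Algebra ℂ M.Alg := inferInstanceAs (Algebra ℂ (RingQuot M.Rel))

/-- The quotient map from the free algebra. -/
noncomputable def proj : FreeAlgebra ℂ X →ₐ[ℂ] M.Alg := RingQuot.mkAlgHom ℂ M.Rel

/-- The universal property of the quotient. -/
noncomputable def lift {R : Type*} [Ring R] [Algebra ℂ R] (f : FreeAlgebra ℂ X →ₐ[ℂ] R)
    (hf : ∀ ⦃u v⦄, M.Rel u v → f u = f v) : M.Alg →ₐ[ℂ] R :=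
  RingQuot.liftAlgHom ℂ ⟨f, hf⟩

@[simp] theorem lift_proj {R : Type*} [Ring R] [Algebra ℂ R] (f : FreeAlgebra ℂ X →ₐ[ℂ] R)
    (hf : ∀ ⦃u v⦄, M.Rel u v → f u = f v) (w : FreeAlgebra ℂ X) :
    M.lift f hf (M.proj w) = f w :=
  RingQuot.liftAlgHom_mkAlgHom_apply ℂ f hf w

/-- A variable, as a polynomial. -/
noncomputable def gen (x : X) : M.Alg := M.proj (FreeAlgebra.ι ℂ x)

/-- A linear combination of variables, as a polynomial. -/
noncomputable def lin : (X →₀ ℂ) →ₗ[ℂ] M.Alg := Finsupp.linearCombination ℂ M.gen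

theorem sgn_add (m n : ℤ) : sgn (m + n) = sgn m * sgn n := by
  simp [sgn, Int.negOnePow_add]

theorem sgn_mul_self (n : ℤ) : sgn n * sgn n = 1 := by
  rw [← sgn_add]; simp [sgn, Int.negOnePow_even _ (Even.add_self n)]

theorem sgn_one : sgn 1 = -1 := by simp [sgn]

theorem gen_swap (x y : X) :
    M.gen x * M.gen y = sgn (M.gh x * M.gh y) • (M.gen y * M.gen x) := by
  have h : M.proj _ = M.proj _ := RingQuot.mkAlgHom_rel ℂ (Rel.swap (M := M) x y)
  simp only [map_mul, map_smul] at h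
  exact h

theorem alg_induction {C : M.Alg → Prop} (hgen : ∀ x, C (M.gen x))
    (hscalar : ∀ r : ℂ, C (algebraMap ℂ M.Alg r)) (hmul : ∀ a b, C a → C b → C (a * b))
    (hadd : ∀ a b, C a → C b → C (a + b)) (P : M.Alg) : C P := by
  obtain ⟨w, rfl⟩ : ∃ w, M.proj w = P := RingQuot.mkAlgHom_surjective ℂ M.Rel P
  induction w using FreeAlgebra.induction with
  | grade0 r => simpa using hscalar r
  | grade1 x => exact hgen x
  | mul a b ha hb => simpa using hmul _ _ ha hb
  | add a b ha hb => simpa using hadd _ _ ha hb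

/-- The parity automorphism `P ↦ (-1) ^ |P| P`. -/
noncomputable def parity : M.Alg →ₐ[ℂ] M.Alg :=
  M.lift (FreeAlgebra.lift ℂ fun x => sgn (M.gh x) • M.gen x) (by
    rintro _ _ ⟨x, y⟩
    simp only [map_mul, map_smul, FreeAlgebra.lift_ι_apply, smul_mul_smul_comm]
    rw [M.gen_swap x y, smul_smul, smul_smul]
    congr 1
    ring)

@[simp] theorem parity_gen (x : X) : M.parity (M.gen x) = sgn (M.gh x) • M.gen x := by
  simp [parity, gen]

theorem lin_op_mul_gen (x y : X) :
    M.lin (M.op x) * M.gen y = sgn ((M.gh x + 1) * M.gh y) • (M.gen y * M.lin (M.op x)) := by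
  rw [lin, Finsupp.linearCombination_apply, Finsupp.sum, Finset.sum_mul, Finset.mul_sum,
    Finset.smul_sum]
  refine Finset.sum_congr rfl fun z hz => ?_
  have h : M.gh z = M.gh x + 1 := (Finsupp.mem_supported ℂ _).1 (M.op_mem x) hz
  rw [smul_mul_assoc, mul_smul_comm, M.gen_swap z y, h, smul_comm]

/-- The algebra homomorphism `P ↦ [[(-1) ^ |P| P, b₀ P], [0, P]]`; that it is multiplicative is the
graded Leibniz rule for `b₀`. -/
noncomputable def matrixHom : M.Alg →ₐ[ℂ] Matrix (Fin 2) (Fin 2) M.Alg :=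
  M.lift (FreeAlgebra.lift ℂ fun x =>
    !![sgn (M.gh x) • M.gen x, M.lin (M.op x); 0, M.gen x]) (by
    rintro _ _ ⟨x, y⟩
    simp only [map_mul, map_smul, FreeAlgebra.lift_ι_apply, Matrix.mul_fin_two,
      mul_zero, zero_mul, add_zero, zero_add, smul_mul_assoc, mul_smul_comm]
    ext i j
    fin_cases i <;> fin_cases j <;> simp only [Fin.zero_eta, Fin.mk_one, Fin.isValue,
      Matrix.smul_apply, Matrix.of_apply, Matrix.cons_val', Matrix.cons_val_zero,
      Matrix.cons_val_one, Matrix.cons_val_fin_one, smul_zero]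
    · rw [M.gen_swap x y, smul_smul, smul_smul, smul_smul, smul_smul]
      congr 1
      ring
    · rw [M.lin_op_mul_gen x y, smul_add, smul_smul, M.lin_op_mul_gen y x, smul_smul,
        add_comm]
      congr 2
      · rw [add_mul, one_mul, sgn_add]
      · rw [add_mul, mul_comm (M.gh y) (M.gh x), sgn_add, ← mul_assoc, sgn_mul_self, one_mul,
          one_mul]
    · exact M.gen_swap x y)

/-- The differential `b₀`: the antiderivation which is `op` on the variables. -/
noncomputable def b₀ : M.Alg →ₗ[ℂ] M.Alg where
  toFun P := M.matrixHom P 0 1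
  map_add' P Q := by simp
  map_smul' r P := by simp

@[simp] theorem matrixHom_gen (x : X) :
    M.matrixHom (M.gen x) = !![sgn (M.gh x) • M.gen x, M.lin (M.op x); 0, M.gen x] := by
  simp [matrixHom, gen]

@[simp] theorem b₀_gen (x : X) : M.b₀ (M.gen x) = M.lin (M.op x) := by
  simp [b₀]

theorem matrixHom_apply (P : M.Alg) : M.matrixHom P = !![M.parity P, M.b₀ P; 0, P] := by
  suffices h : M.matrixHom P 0 0 = M.parity P ∧ M.matrixHom P 1 0 = 0 ∧ M.matrixHom P 1 1 = P by
    ext i j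
    fin_cases i <;> fin_cases j <;> simp [h, b₀]
  induction P using M.alg_induction with
  | hgen x => simp
  | hscalar r => simp [Matrix.algebraMap_matrix_apply]
  | hmul a b ha hb => simp [Matrix.mul_apply, ha, hb]
  | hadd a b ha hb => simp [ha, hb]

/-- The graded Leibniz rule. -/
theorem b₀_mul (P Q : M.Alg) : M.b₀ (P * Q) = M.b₀ P * Q + M.parity P * M.b₀ Q := by
  have h := congrFun (congrFun (map_mul M.matrixHom P Q) 0) 1
  rw [M.matrixHom_apply P, M.matrixHom_apply Q, M.matrixHom_apply (P * Q)] at h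
  simpa [Matrix.mul_apply, add_comm] using h

@[simp] theorem b₀_algebraMap (r : ℂ) : M.b₀ (algebraMap ℂ M.Alg r) = 0 := by
  simp [b₀, Matrix.algebraMap_matrix_apply]

theorem b₀_parity (P : M.Alg) : M.b₀ (M.parity P) = -M.parity (M.b₀ P) := by
  induction P using M.alg_induction with
  | hgen x =>
    rw [parity_gen, map_smul, b₀_gen, lin, Finsupp.linearCombination_apply, Finsupp.sum, map_sum,
      Finset.smul_sum, ← Finset.sum_neg_distrib]
    refine Finset.sum_congr rfl fun z hz => ?_
    have h : M.gh z = M.gh x + 1 := (Finsupp.mem_supported ℂ _).1 (M.op_mem x) hz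
    rw [map_smul, parity_gen, h, sgn_add, sgn_one, smul_comm]
    module
  | hscalar r => simp
  | hmul a b ha hb =>
    simp only [map_mul, b₀_mul, ha, hb, map_add, neg_mul, mul_neg, neg_add]
  | hadd a b ha hb => simp [ha, hb, add_comm]

theorem b₀_b₀ (P : M.Alg) : M.b₀ (M.b₀ P) = 0 := by
  induction P using M.alg_induction with
  | hgen x =>
    have h : M.b₀ ∘ₗ M.lin = M.lin ∘ₗ Finsupp.linearCombination ℂ M.op := by
      ext y; simp [lin]
    have h' := LinearMap.congr_fun h (M.op x)
    simp only [LinearMap.comp_apply, M.op_op, map_zero] at h'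
    rw [b₀_gen, h']
  | hscalar r => simp
  | hmul a b ha hb => simp [b₀_mul, ha, hb, b₀_parity]
  | hadd a b ha hb => simp [ha, hb]

/-- The polynomials of ghost number `p`: the span of the monomials of total ghost number `p`. -/
noncomputable def ghostPart (p : ℤ) : Submodule ℂ M.Alg :=
  Submodule.span ℂ {P | ∃ l : List X, (l.map M.gh).sum = p ∧ P = (l.map M.gen).prod}

theorem mul_mem_ghostPart {p q : ℤ} {P Q : M.Alg} (hP : P ∈ M.ghostPart p)
    (hQ : Q ∈ M.ghostPart q) : P * Q ∈ M.ghostPart (p + q) := by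
  have h := Submodule.mul_mem_mul hP hQ
  rw [ghostPart, ghostPart, Submodule.span_mul_span] at h
  refine Submodule.span_mono ?_ h
  rintro _ ⟨_, ⟨l, rfl, rfl⟩, _, ⟨k, rfl, rfl⟩, rfl⟩
  exact ⟨l ++ k, by simp, by simp⟩

theorem gen_mem_ghostPart (x : X) : M.gen x ∈ M.ghostPart (M.gh x) :=
  Submodule.subset_span ⟨[x], by simp, by simp⟩

theorem b₀_mem_ghostPart {p : ℤ} {P : M.Alg} (hP : P ∈ M.ghostPart p) :
    M.b₀ P ∈ M.ghostPart (p + 1) := by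
  induction hP using Submodule.span_induction with
  | zero => simp
  | add _ _ _ _ h h' => rw [map_add]; exact Submodule.add_mem _ h h'
  | smul r _ _ h => rw [map_smul]; exact Submodule.smul_mem _ r h
  | mem _ h =>
    obtain ⟨l, rfl, rfl⟩ := h
    induction l with
    | nil =>
      have h1 : M.b₀ 1 = 0 := by simpa using M.b₀_algebraMap 1
      simp [h1]
    | cons x l ih =>
      simp only [List.map_cons, List.prod_cons, List.sum_cons, b₀_mul, b₀_gen, parity_gen]
      have hx : M.lin (M.op x) ∈ M.ghostPart (M.gh x + 1) := by
        rw [lin, Finsupp.linearCombination_apply]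
        refine Submodule.sum_mem _ fun z hz => Submodule.smul_mem _ _ ?_
        have h : M.gh z = M.gh x + 1 := (Finsupp.mem_supported ℂ _).1 (M.op_mem x) hz
        exact h ▸ M.gen_mem_ghostPart z
      refine Submodule.add_mem _ ?_ ?_
      · rw [add_right_comm]
        exact M.mul_mem_ghostPart hx (Submodule.subset_span ⟨l, rfl, rfl⟩)
      · rw [add_assoc]
        exact M.mul_mem_ghostPart (Submodule.smul_mem _ _ (M.gen_mem_ghostPart x)) ih

/-- Local `q`-forms on three-dimensional space: the component along
`dx^{I 0} ∧ ⋯ ∧ dx^{I (q - 1)}` is a polynomial, for each increasing multi-index `I`. -/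
abbrev Form (q : ℕ) : Type _ := (Fin q ↪o Fin 3) → M.Alg

/-- The differential on local forms, acting on the components. -/
noncomputable def b₀Form (q : ℕ) : M.Form q →ₗ[ℂ] M.Form q := M.b₀.compLeft (Fin q ↪o Fin 3)

/-- Local `q`-forms of ghost number `p`. -/
noncomputable def forms (p : ℤ) (q : ℕ) : Submodule ℂ (M.Form q) :=
  Submodule.pi Set.univ fun _ => M.ghostPart p

/-- Closed local `q`-forms of ghost number `p`. -/
noncomputable def cocycles (p : ℤ) (q : ℕ) : Submodule ℂ (M.Form q) :=
  M.forms p q ⊓ LinearMap.ker (M.b₀Form q)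

/-- Exact local `q`-forms of ghost number `p`. -/
noncomputable def coboundaries (p : ℤ) (q : ℕ) : Submodule ℂ (M.Form q) :=
  (M.forms (p - 1) q).map (M.b₀Form q)

theorem coboundaries_le_cocycles (p : ℤ) (q : ℕ) : M.coboundaries p q ≤ M.cocycles p q := by
  rintro _ ⟨ω, hω, rfl⟩
  refine ⟨fun I _ => ?_, ?_⟩
  · have h := M.b₀_mem_ghostPart (hω I trivial)
    rw [sub_add_cancel] at h
    exact h
  · exact funext fun I => M.b₀_b₀ (ω I)

/-- The local cohomology of `b₀` in ghost number `p` and form degree `q`. -/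
abbrev Cohomology (p : ℤ) (q : ℕ) : Type _ :=
  M.cocycles p q ⧸ (M.coboundaries p q).submoduleOf (M.cocycles p q)

/-- The cohomology class of a cocycle. -/
noncomputable def cls {p : ℤ} {q : ℕ} (ω : M.cocycles p q) : M.Cohomology p q :=
  Submodule.Quotient.mk ω

end LinearModel

/-! ### Jet variables in three dimensions -/

/-- The jet variables `∂_α f^a`: a field component `f`, an index `a` of a basis of the Lie algebra
of the gauge group, and a multi-index `α` of partial derivatives. -/
abbrev Jet (F ι : Type*) : Type _ := F × ι × (Fin 3 →₀ ℕ)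

section Jets

variable {F ι : Type*}

/-- The jet variable `∂_α f^a` as a linear combination of jet variables. -/
noncomputable def jet (f : F) (a : ι) (α : Fin 3 →₀ ℕ) : Jet F ι →₀ ℂ :=
  Finsupp.single (f, a, α) 1

/-- The multi-index with one more derivative along `x^μ`. -/
noncomputable def up (α : Fin 3 →₀ ℕ) (μ : Fin 3) : Fin 3 →₀ ℕ := α + Finsupp.single μ 1

/-- `∂_α (∂_μ V_ν^a - ∂_ν V_μ^a)`, the components of `dV` and their derivatives. -/
noncomputable def extd (V : Fin 3 → F) (μ ν : Fin 3) (a : ι) (α : Fin 3 →₀ ℕ) : Jet F ι →₀ ℂ :=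
  jet (V ν) a (up α μ) - jet (V μ) a (up α ν)

/-- `∂_α (* dV^a)_μ`; indices are modulo `3`, so that `(μ, μ + 1, μ + 2)` is cyclic. -/
noncomputable def starD (V : Fin 3 → F) (μ : Fin 3) (a : ι) (α : Fin 3 →₀ ℕ) : Jet F ι →₀ ℂ :=
  extd V (μ + 1) (μ + 2) a α

/-- `∂_α (* d * V^a) = ∂_α ∑_μ ∂_μ V_μ^a`. -/
noncomputable def dDag (V : Fin 3 → F) (a : ι) (α : Fin 3 →₀ ℕ) : Jet F ι →₀ ℂ :=
  ∑ μ, jet (V μ) a (up α μ)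

theorem up_comm (α : Fin 3 →₀ ℕ) (μ ν : Fin 3) : up (up α μ) ν = up (up α ν) μ :=
  add_right_comm _ _ _

theorem jet_mem {s : Set (Jet F ι)} {f : F} {a : ι} {α : Fin 3 →₀ ℕ} (h : (f, a, α) ∈ s) :
    jet f a α ∈ Finsupp.supported ℂ ℂ s :=
  Finsupp.single_mem_supported ℂ _ h

theorem extd_mem {s : Set (Jet F ι)} {V : Fin 3 → F} {a : ι}
    (h : ∀ ν α, (V ν, a, α) ∈ s) (μ ν : Fin 3) (α : Fin 3 →₀ ℕ) :
    extd V μ ν a α ∈ Finsupp.supported ℂ ℂ s :=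
  Submodule.sub_mem _ (jet_mem (h _ _)) (jet_mem (h _ _))

theorem dDag_mem {s : Set (Jet F ι)} {V : Fin 3 → F} {a : ι}
    (h : ∀ ν α, (V ν, a, α) ∈ s) (α : Fin 3 →₀ ℕ) :
    dDag V a α ∈ Finsupp.supported ℂ ℂ s :=
  Submodule.sum_mem _ fun _ _ => jet_mem (h _ _)

end Jets

/-! ### The gaussian model -/

/-- The components of the fields and external sources of the gaussian model. The source `ΩA` is the
combination of the source of `A` with the gradient of the antighost. -/
inductive GaussField
  | A (μ : Fin 3)
  | B (μ : Fin 3)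
  | c
  | ΩA (μ : Fin 3)
  | ΩB (μ : Fin 3)
  | Ωc

namespace GaussField

/-- Ghost numbers. -/
def gh : GaussField → ℤ
  | A _ => 0
  | B _ => 0
  | c => 1
  | ΩA _ => -1
  | ΩB _ => -1
  | Ωc => -2

/-- The linear part of the Slavnov-Taylor operator:
`A ↦ -dc`, `B ↦ 0`, `c ↦ 0`, `ΩA ↦ i * dB + i m * dA`, `ΩB ↦ i * dA + 2 B`, `Ωc ↦ d† ΩA`. -/
noncomputable def op {ι : Type*} (m : ℂ) : Jet GaussField ι → (Jet GaussField ι →₀ ℂ)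
  | (A μ, a, α) => -jet c a (up α μ)
  | (B _, _, _) => 0
  | (c, _, _) => 0
  | (ΩA μ, a, α) => Complex.I • starD B μ a α + (Complex.I * m) • starD A μ a α
  | (ΩB μ, a, α) => Complex.I • starD A μ a α + (2 : ℂ) • jet (B μ) a α
  | (Ωc, a, α) => dDag ΩA a α

end GaussField

open GaussField in
/-- The algebra of local polynomials of the gaussian model with its operator `b₀`. -/
noncomputable def gaussian (ι : Type*) (m : ℂ) : LinearModel (Jet GaussField ι) where
  gh x := x.1.gh
  op := GaussField.op m
  op_mem := by
    rintro ⟨_ | _ | _ | _ | _ | _, a, α⟩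
    · exact Submodule.neg_mem _ (jet_mem rfl)
    · exact Submodule.zero_mem _
    · exact Submodule.zero_mem _
    · exact Submodule.add_mem _ (Submodule.smul_mem _ _ (extd_mem (fun _ _ => rfl) _ _ _))
        (Submodule.smul_mem _ _ (extd_mem (fun _ _ => rfl) _ _ _))
    · exact Submodule.add_mem _ (Submodule.smul_mem _ _ (extd_mem (fun _ _ => rfl) _ _ _))
        (Submodule.smul_mem _ _ (jet_mem rfl))
    · exact dDag_mem (fun _ _ => rfl) _
  op_op := by
    rintro ⟨μ | μ | _ | μ | μ | _, a, α⟩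
    · simp [GaussField.op, jet]
    · simp [GaussField.op]
    · simp [GaussField.op]
    · simp [GaussField.op, jet, starD, extd, up_comm]
    · simp [GaussField.op, jet, starD, extd, up_comm]
    · simp only [GaussField.op, jet, starD, extd, dDag, Fin.sum_univ_three, map_add,
        Finsupp.linearCombination_single, one_smul, Fin.isValue, Fin.reduceAdd, zero_add]
      rw [up_comm α 1 0, up_comm α 2 0, up_comm α 2 1]
      module

/-! ### The extended model -/

/-- The components of the fields and external sources of the extended model. The sources `ΩA`, `ΩB`
are combined with the gradients of the antighosts. -/
inductive ExtField
  | A (μ : Fin 3)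
  | B (μ : Fin 3)
  | η
  | c
  | φ
  | ΩA (μ : Fin 3)
  | ΩB (μ : Fin 3)
  | Ωη
  | Ωc
  | Ωφ

namespace ExtField

/-- Ghost numbers. -/
def gh : ExtField → ℤ
  | A _ => 0
  | B _ => 0
  | η => 0
  | c => 1
  | φ => 1
  | ΩA _ => -1
  | ΩB _ => -1
  | Ωη => -1
  | Ωc => -2
  | Ωφ => -2

/-- The linear part of the Slavnov-Taylor operator:
`A ↦ -dc`, `B ↦ -dφ`, `η ↦ φ`, `c ↦ 0`, `φ ↦ 0`, `ΩA ↦ i * dB + i m * dA`,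
`ΩB ↦ i * dA + 2 (B + dη)`, `Ωη ↦ -2 d† (B + dη)`, `Ωc ↦ -d† ΩA`, `Ωφ ↦ -d† ΩB - Ωη`. -/
noncomputable def op {ι : Type*} (m : ℂ) : Jet ExtField ι → (Jet ExtField ι →₀ ℂ)
  | (A μ, a, α) => -jet c a (up α μ)
  | (B μ, a, α) => -jet φ a (up α μ)
  | (η, a, α) => jet φ a α
  | (c, _, _) => 0
  | (φ, _, _) => 0
  | (ΩA μ, a, α) => Complex.I • starD B μ a α + (Complex.I * m) • starD A μ a α
  | (ΩB μ, a, α) => Complex.I • starD A μ a α + (2 : ℂ) • (jet (B μ) a α + jet η a (up α μ))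
  | (Ωη, a, α) => (-2 : ℂ) • (dDag B a α + ∑ μ, jet η a (up (up α μ) μ))
  | (Ωc, a, α) => -dDag ΩA a α
  | (Ωφ, a, α) => -dDag ΩB a α - jet Ωη a α

end ExtField

open ExtField in
/-- The algebra of local polynomials of the extended model with its operator `b₀`. -/
noncomputable def extended (ι : Type*) (m : ℂ) : LinearModel (Jet ExtField ι) where
  gh x := x.1.gh
  op := ExtField.op m
  op_mem := by
    rintro ⟨_ | _ | _ | _ | _ | _ | _ | _ | _ | _, a, α⟩
    · exact Submodule.neg_mem _ (jet_mem rfl)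
    · exact Submodule.neg_mem _ (jet_mem rfl)
    · exact jet_mem rfl
    · exact Submodule.zero_mem _
    · exact Submodule.zero_mem _
    · exact Submodule.add_mem _ (Submodule.smul_mem _ _ (extd_mem (fun _ _ => rfl) _ _ _))
        (Submodule.smul_mem _ _ (extd_mem (fun _ _ => rfl) _ _ _))
    · exact Submodule.add_mem _ (Submodule.smul_mem _ _ (extd_mem (fun _ _ => rfl) _ _ _))
        (Submodule.smul_mem _ _ (Submodule.add_mem _ (jet_mem rfl) (jet_mem rfl)))
    · exact Submodule.smul_mem _ _ (Submodule.add_mem _ (dDag_mem (fun _ _ => rfl) _)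
        (Submodule.sum_mem _ fun _ _ => jet_mem rfl))
    · exact Submodule.neg_mem _ (dDag_mem (fun _ _ => rfl) _)
    · exact Submodule.sub_mem _ (Submodule.neg_mem _ (dDag_mem (fun _ _ => rfl) _)) (jet_mem rfl)
  op_op := by
    rintro ⟨μ | μ | _ | _ | _ | μ | μ | _ | _ | _, a, α⟩
    · simp [ExtField.op, jet]
    · simp [ExtField.op, jet]
    · simp [ExtField.op, jet]
    · simp [ExtField.op]
    · simp [ExtField.op]
    · simp [ExtField.op, jet, starD, extd, up_comm]
    · simp [ExtField.op, jet, starD, extd, up_comm]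
    · simp [ExtField.op, jet, dDag, ← Finset.sum_add_distrib]
    · simp only [ExtField.op, jet, starD, extd, dDag, Fin.sum_univ_three, map_add, map_neg,
        Finsupp.linearCombination_single, one_smul, Fin.isValue, Fin.reduceAdd, zero_add]
      rw [up_comm α 1 0, up_comm α 2 0, up_comm α 2 1]
      module
    · simp only [ExtField.op, jet, starD, extd, dDag, Fin.sum_univ_three, map_add, map_neg,
        map_sub, Finsupp.linearCombination_single, one_smul, Fin.isValue, Fin.reduceAdd, zero_add]
      rw [up_comm α 1 0, up_comm α 2 0, up_comm α 2 1]
      module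

/-! ### The polynomials in `dA`, `c`, `B` -/

section Invariant

variable {F ι : Type*} (M : LinearModel (Jet F ι)) (A B : Fin 3 → F) (c : F)

/-- The polynomials in `dA` and its derivatives, the undifferentiated `c`, and `B` and its
derivatives. -/
noncomputable def depAlg : Subalgebra ℂ M.Alg :=
  Algebra.adjoin ℂ
    ({P | ∃ μ ν a α, P = M.lin (extd A μ ν a α)} ∪ {P | ∃ a, P = M.gen (c, a, 0)} ∪
      {P | ∃ μ a α, P = M.gen (B μ, a, α)})

end Invariant

end BFYM

/-! The differential `b₀` is linear on the variables, so the whole problem reduces to the complex of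
linear combinations of jet variables.

For that complex, `exists_lowering` builds a linear map `h` of degree `-1` for which the
anticommutator of `h` and `b₀` is idempotent on linear elements and differs from the identity by
elements of the span `W` of `dA`, undifferentiated `c`, and `B`. Extend `h` to an antiderivation `K`
of the full algebra. The operator `N = b₀ K + K b₀` (`number`) is then a derivation commuting with
`b₀`. The algebra is spanned by eigenvectors of `N` with eigenvalues in `ℕ`, and those of eigenvalue
`0` lie in the subalgebra generated by `W`. On a cocycle `N = b₀ K`, so nonzero eigenvalues
contribute only coboundaries (`exists_sub_b₀_mem`).

The input is that every linear cocycle is cohomologous to an element of `W`. For a fixed Lie algebra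
index, a combination of derivatives of a field is a polynomial in three variables, and `b₀` becomes
a matrix of polynomials. Fields of ghost number `0` and `1` are handled by Koszul exactness. For the
sources the closure equations say that a vector `y` is an eigenvector of the curl and is
divergence-free, so that a Laplacian minus a constant kills it; hence `y = 0` whatever `m` is
(`exists_of_source_closed`). -/

namespace BFYM

namespace LinearModel

variable {X : Type*} (M : LinearModel X)

/-! ### The linear complex inside the algebra -/

/-- The differential on linear combinations of variables. -/
noncomputable def linOp : (X →₀ ℂ) →ₗ[ℂ] (X →₀ ℂ) := Finsupp.linearCombination ℂ M.op

/-- The linear combinations of variables of ghost number `p`. -/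
noncomputable def linPart (p : ℤ) : Submodule ℂ (X →₀ ℂ) :=
  Finsupp.supported ℂ ℂ {y | M.gh y = p}

theorem b₀_lin (v : X →₀ ℂ) : M.b₀ (M.lin v) = M.lin (M.linOp v) := by
  have h : M.b₀ ∘ₗ M.lin = M.lin ∘ₗ M.linOp := by
    ext y; simp [lin, linOp]
  exact LinearMap.congr_fun h v

theorem linOp_linOp (v : X →₀ ℂ) : M.linOp (M.linOp v) = 0 := by
  have h : M.linOp ∘ₗ M.linOp = 0 := by
    ext1 y; ext1; simpa [linOp] using M.op_op y
  exact LinearMap.congr_fun h v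

theorem single_mem_linPart (x : X) : Finsupp.single x 1 ∈ M.linPart (M.gh x) :=
  Finsupp.single_mem_supported ℂ _ rfl

/-- Reduces statements about a graded piece to single variables; with `T = ⊥` it proves identities
of linear maps that hold only on that piece. -/
theorem map_mem_of_single {V : Type*} [AddCommGroup V] [Module ℂ V] {s : Set X}
    {T : Submodule ℂ V} {g : (X →₀ ℂ) →ₗ[ℂ] V} (hg : ∀ x ∈ s, g (Finsupp.single x 1) ∈ T)
    {v : X →₀ ℂ} (hv : v ∈ Finsupp.supported ℂ ℂ s) : g v ∈ T := by
  rw [Finsupp.supported_eq_span_single] at hv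
  induction hv using Submodule.span_induction with
  | zero => simp
  | add _ _ _ _ h h' => rw [map_add]; exact T.add_mem h h'
  | smul r _ _ h => rw [map_smul]; exact T.smul_mem r h
  | mem _ h => obtain ⟨x, hx, rfl⟩ := h; exact hg x hx

theorem linOp_mem {p : ℤ} {v : X →₀ ℂ} (hv : v ∈ M.linPart p) : M.linOp v ∈ M.linPart (p + 1) := by
  refine map_mem_of_single (fun x hx => ?_) hv
  have h := M.op_mem x
  rw [show M.gh x = p from hx] at h
  simpa [linOp, linPart] using h

theorem lin_mem_ghostPart {p : ℤ} {v : X →₀ ℂ} (hv : v ∈ M.linPart p) :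
    M.lin v ∈ M.ghostPart p := by
  refine map_mem_of_single (fun x hx => ?_) hv
  rw [← show M.gh x = p from hx]
  simpa [lin] using M.gen_mem_ghostPart x

theorem parity_lin {p : ℤ} {v : X →₀ ℂ} (hv : v ∈ M.linPart p) :
    M.parity (M.lin v) = sgn p • M.lin v := by
  have h := map_mem_of_single (g := M.parity.toLinearMap ∘ₗ M.lin - sgn p • M.lin) (T := ⊥)
    (fun x hx => ?_) hv
  · simpa [sub_eq_zero] using h
  · rw [← show M.gh x = p from hx]
    simp [lin]

theorem lin_mul_gen {p : ℤ} {v : X →₀ ℂ} (hv : v ∈ M.linPart p) (y : X) :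
    M.lin v * M.gen y = sgn (p * M.gh y) • (M.gen y * M.lin v) := by
  have h := map_mem_of_single (T := ⊥) (g := LinearMap.mulRight ℂ (M.gen y) ∘ₗ M.lin -
    sgn (p * M.gh y) • (LinearMap.mulLeft ℂ (M.gen y) ∘ₗ M.lin)) (fun x hx => ?_) hv
  · simpa [sub_eq_zero] using h
  · rw [← show M.gh x = p from hx]
    simp [lin, M.gen_swap x y]

@[simp] theorem parity_parity (P : M.Alg) : M.parity (M.parity P) = P := by
  induction P using M.alg_induction with
  | hgen x => simp [smul_smul, sgn_mul_self]
  | hscalar r => simp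
  | hmul a b ha hb => simp [ha, hb]
  | hadd a b ha hb => simp [ha, hb]

/-! ### Odd antiderivations of degree `-1` -/

/-- A linear map of degree `-1` on the variables. -/
structure Lowering where
  /-- The image of a variable. -/
  op : X → (X →₀ ℂ)
  op_mem : ∀ x, op x ∈ M.linPart (M.gh x - 1)

namespace Lowering

variable {M} (h : M.Lowering)

/-- The linear extension to linear combinations of variables. -/
noncomputable def linOp : (X →₀ ℂ) →ₗ[ℂ] (X →₀ ℂ) := Finsupp.linearCombination ℂ h.op

/-- The algebra homomorphism `P ↦ [[(-1) ^ |P| P, K P], [0, P]]`, where `K` is the antiderivation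
extending `h`. -/
noncomputable def matrixHom : M.Alg →ₐ[ℂ] Matrix (Fin 2) (Fin 2) M.Alg :=
  M.lift (FreeAlgebra.lift ℂ fun x =>
    !![sgn (M.gh x) • M.gen x, M.lin (h.op x); 0, M.gen x]) (by
    have hs (m n : ℤ) : sgn ((m - 1) * n) = sgn (m * n) * sgn n := by
      rw [show m * n = (m - 1) * n + n by ring, sgn_add, mul_assoc, sgn_mul_self, mul_one]
    rintro _ _ ⟨x, y⟩
    simp only [map_mul, map_smul, FreeAlgebra.lift_ι_apply, Matrix.mul_fin_two,
      mul_zero, zero_mul, add_zero, zero_add, smul_mul_assoc, mul_smul_comm]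
    ext i j
    fin_cases i <;> fin_cases j <;> simp only [Fin.zero_eta, Fin.mk_one, Fin.isValue,
      Matrix.smul_apply, Matrix.of_apply, Matrix.cons_val', Matrix.cons_val_zero,
      Matrix.cons_val_one, Matrix.cons_val_fin_one, smul_zero]
    · rw [M.gen_swap x y, smul_smul, smul_smul, smul_smul, smul_smul]
      congr 1
      ring
    · rw [M.lin_mul_gen (h.op_mem x) y, smul_add, smul_smul, M.lin_mul_gen (h.op_mem y) x,
        smul_smul, add_comm, hs, hs, mul_comm (M.gh y) (M.gh x), ← mul_assoc, sgn_mul_self, one_mul]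
    · exact M.gen_swap x y)

/-- The antiderivation of degree `-1` which is `h` on the variables. -/
noncomputable def antiderivation : M.Alg →ₗ[ℂ] M.Alg where
  toFun P := h.matrixHom P 0 1
  map_add' P Q := by simp
  map_smul' r P := by simp

@[simp] theorem matrixHom_gen (x : X) :
    h.matrixHom (M.gen x) = !![sgn (M.gh x) • M.gen x, M.lin (h.op x); 0, M.gen x] := by
  simp [matrixHom, gen]

@[simp] theorem antiderivation_gen (x : X) : h.antiderivation (M.gen x) = M.lin (h.op x) := by
  simp [antiderivation]

theorem matrixHom_apply (P : M.Alg) :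
    h.matrixHom P = !![M.parity P, h.antiderivation P; 0, P] := by
  suffices H : h.matrixHom P 0 0 = M.parity P ∧ h.matrixHom P 1 0 = 0 ∧ h.matrixHom P 1 1 = P by
    ext i j
    fin_cases i <;> fin_cases j <;> simp [H, antiderivation]
  induction P using M.alg_induction with
  | hgen x => simp
  | hscalar r => simp [Matrix.algebraMap_matrix_apply]
  | hmul a b ha hb => simp [Matrix.mul_apply, ha, hb]
  | hadd a b ha hb => simp [ha, hb]

/-- The Leibniz rule is the upper right entry of the multiplicativity of `matrixHom`. -/
theorem antiderivation_mul (P Q : M.Alg) : h.antiderivation (P * Q) =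
    h.antiderivation P * Q + M.parity P * h.antiderivation Q := by
  have H := congrFun (congrFun (map_mul h.matrixHom P Q) 0) 1
  rw [h.matrixHom_apply P, h.matrixHom_apply Q, h.matrixHom_apply (P * Q)] at H
  simpa [Matrix.mul_apply, add_comm] using H

@[simp] theorem antiderivation_algebraMap (r : ℂ) :
    h.antiderivation (algebraMap ℂ M.Alg r) = 0 := by
  simp [antiderivation, Matrix.algebraMap_matrix_apply]

theorem antiderivation_lin (v : X →₀ ℂ) : h.antiderivation (M.lin v) = M.lin (h.linOp v) := by
  have H : h.antiderivation ∘ₗ M.lin = M.lin ∘ₗ h.linOp := by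
    ext y; simp [lin, linOp]
  exact LinearMap.congr_fun H v

theorem antiderivation_parity (P : M.Alg) :
    h.antiderivation (M.parity P) = -M.parity (h.antiderivation P) := by
  induction P using M.alg_induction with
  | hgen x =>
    rw [parity_gen, map_smul, antiderivation_gen, M.parity_lin (h.op_mem x), ← neg_smul,
      show M.gh x = (M.gh x - 1) + 1 by ring, sgn_add, sgn_one]
    simp
  | hscalar r => simp
  | hmul a b ha hb =>
    simp only [map_mul, antiderivation_mul, ha, hb, map_add, neg_mul, mul_neg, neg_add]
  | hadd a b ha hb => simp [ha, hb, add_comm]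

theorem antiderivation_mem_ghostPart {p : ℤ} {P : M.Alg} (hP : P ∈ M.ghostPart p) :
    h.antiderivation P ∈ M.ghostPart (p - 1) := by
  induction hP using Submodule.span_induction with
  | zero => simp
  | add _ _ _ _ H H' => rw [map_add]; exact Submodule.add_mem _ H H'
  | smul r _ _ H => rw [map_smul]; exact Submodule.smul_mem _ r H
  | mem _ H =>
    obtain ⟨l, rfl, rfl⟩ := H
    induction l with
    | nil =>
      have h1 : h.antiderivation 1 = 0 := by simpa using h.antiderivation_algebraMap 1
      simp [h1]
    | cons x l ih =>
      simp only [List.map_cons, List.prod_cons, List.sum_cons, antiderivation_mul,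
        antiderivation_gen, parity_gen]
      refine Submodule.add_mem _ ?_ ?_
      · rw [add_sub_right_comm]
        exact M.mul_mem_ghostPart (M.lin_mem_ghostPart (h.op_mem x))
          (Submodule.subset_span ⟨l, rfl, rfl⟩)
      · rw [add_sub_assoc]
        exact M.mul_mem_ghostPart (Submodule.smul_mem _ _ (M.gen_mem_ghostPart x)) ih

/-! ### The number operator and its eigenvalues -/

/-- The anticommutator of `b₀` with the antiderivation; it is a derivation. -/
noncomputable def number : Module.End ℂ M.Alg :=
  M.b₀ ∘ₗ h.antiderivation + h.antiderivation ∘ₗ M.b₀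

theorem number_apply (P : M.Alg) :
    h.number P = M.b₀ (h.antiderivation P) + h.antiderivation (M.b₀ P) := rfl

/-- Both operators are odd and anticommute with `parity`, so the mixed terms cancel and no sign
survives. -/
theorem number_mul (P Q : M.Alg) : h.number (P * Q) = h.number P * Q + P * h.number Q := by
  simp only [number_apply, antiderivation_mul, b₀_mul, map_add, b₀_parity, antiderivation_parity,
    parity_parity]
  noncomm_ring

@[simp] theorem number_algebraMap (r : ℂ) : h.number (algebraMap ℂ M.Alg r) = 0 := by
  simp [number_apply]

theorem number_lin (v : X →₀ ℂ) :
    h.number (M.lin v) = M.lin (M.linOp (h.linOp v) + h.linOp (M.linOp v)) := by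
  simp [number_apply, antiderivation_lin, b₀_lin]

/-- Since `b₀` squares to zero, both sides are `b₀ K b₀ P`, with `K` the antiderivation. -/
theorem b₀_number (P : M.Alg) : M.b₀ (h.number P) = h.number (M.b₀ P) := by
  simp [number_apply, b₀_b₀]

theorem number_mem_ghostPart {p : ℤ} {P : M.Alg} (hP : P ∈ M.ghostPart p) :
    h.number P ∈ M.ghostPart p := by
  refine Submodule.add_mem _ ?_ ?_
  · simpa using M.b₀_mem_ghostPart (h.antiderivation_mem_ghostPart hP)
  · simpa using h.antiderivation_mem_ghostPart (M.b₀_mem_ghostPart hP)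

open Polynomial in
theorem aeval_number_mem_ghostPart (f : ℂ[X]) {p : ℤ} {P : M.Alg} (hP : P ∈ M.ghostPart p) :
    aeval h.number f P ∈ M.ghostPart p := by
  induction f using Polynomial.induction_on' with
  | add f g hf hg => simpa using Submodule.add_mem _ hf hg
  | monomial n r =>
    simp only [aeval_monomial, Module.End.mul_apply, Module.algebraMap_end_apply]
    refine Submodule.smul_mem _ _ ?_
    induction n with
    | zero => simpa
    | succ n ih => rw [pow_succ', Module.End.mul_apply]; exact h.number_mem_ghostPart ih

open Polynomial in
theorem b₀_aeval_number (f : ℂ[X]) (P : M.Alg) :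
    M.b₀ (aeval h.number f P) = aeval h.number f (M.b₀ P) := by
  induction f using Polynomial.induction_on' with
  | add f g hf hg => simp [hf, hg]
  | monomial n r =>
    simp only [aeval_monomial, Module.End.mul_apply, Module.algebraMap_end_apply, map_smul]
    congr 1
    induction n with
    | zero => simp
    | succ n ih => rw [pow_succ', Module.End.mul_apply, b₀_number, ih, Module.End.mul_apply]

/-- If `h` contracts the linear combinations of variables onto elements of the subalgebra `S`, then
the algebra is spanned by eigenvectors of `number` with eigenvalues in `ℕ`, those of eigenvalue `0`
being in `S`. -/
theorem mem_span_eigenvectors (S : Subalgebra ℂ M.Alg)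
    (hN : ∀ P ∈ LinearMap.range M.lin, h.number (h.number P) = h.number P)
    (hS : ∀ P ∈ LinearMap.range M.lin, P - h.number P ∈ S) (P : M.Alg) :
    P ∈ Submodule.span ℂ {Q | ∃ k : ℕ, h.number Q = (k : ℂ) • Q ∧ (k = 0 → Q ∈ S)} := by
  induction P using M.alg_induction with
  | hgen x =>
    have hx : M.gen x ∈ LinearMap.range M.lin := ⟨Finsupp.single x 1, by simp [lin]⟩
    -- Idempotence on linear elements splits a variable into eigenvectors of eigenvalues `0` and
    -- `1`.
    rw [← sub_add_cancel (M.gen x) (h.number (M.gen x))]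
    refine Submodule.add_mem _ (Submodule.subset_span ⟨0, ?_, fun _ => hS _ hx⟩)
      (Submodule.subset_span ⟨1, ?_, by simp⟩)
    · simp [hN _ hx]
    · simp [hN _ hx]
  | hscalar r => exact Submodule.subset_span ⟨0, by simp, fun _ => S.algebraMap_mem r⟩
  | hadd a b ha hb => exact Submodule.add_mem _ ha hb
  | hmul a b ha hb =>
    have H := Submodule.mul_mem_mul ha hb
    rw [Submodule.span_mul_span] at H
    refine Submodule.span_mono ?_ H
    rintro _ ⟨Q, ⟨k, hk, hkS⟩, R, ⟨l, hl, hlS⟩, rfl⟩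
    -- Eigenvalues add under products because `number` is a derivation; being natural numbers, they
    -- sum to `0` only if both vanish.
    refine ⟨k + l, ?_, fun e => S.mul_mem (hkS (by omega)) (hlS (by omega))⟩
    simp [number_mul, hk, hl, add_smul]

open Polynomial in
-- Take for `f` a product of factors `X - k` over the nonzero eigenvalues occurring in `P`. It kills
-- every component except that of eigenvalue `0`, and its constant term is nonzero. This replaces a
-- direct sum decomposition into eigenspaces.
theorem exists_aeval_number_mem (S : Subalgebra ℂ M.Alg)
    (hN : ∀ P ∈ LinearMap.range M.lin, h.number (h.number P) = h.number P)
    (hS : ∀ P ∈ LinearMap.range M.lin, P - h.number P ∈ S) (P : M.Alg) :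
    ∃ f : ℂ[X], f.coeff 0 ≠ 0 ∧ aeval h.number f P ∈ S := by
  -- Here `Q` is the component of eigenvalue `0`, on which `f(N)` acts as the scalar `f.coeff 0`.
  -- Keeping `Q` explicit makes the claim stable under sums.
  suffices H : ∃ f : ℂ[X], f.coeff 0 ≠ 0 ∧
      ∃ Q ∈ S, h.number Q = 0 ∧ aeval h.number f (P - Q) = 0 by
    obtain ⟨f, hf, Q, hQ, hQ0, hPQ⟩ := H
    refine ⟨f, hf, ?_⟩
    rw [map_sub, sub_eq_zero] at hPQ
    rw [hPQ, ← divX_mul_X_add f]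
    simpa [hQ0] using S.smul_mem hQ _
  have H := h.mem_span_eigenvectors S hN hS P
  induction H using Submodule.span_induction with
  | zero => exact ⟨1, by simp, 0, S.zero_mem, by simp, by simp⟩
  | add a b _ _ ha hb =>
    obtain ⟨f, hf, Q, hQ, hQ0, hPQ⟩ := ha
    obtain ⟨g, hg, R, hR, hR0, hPR⟩ := hb
    refine ⟨f * g, by simp [mul_coeff_zero, hf, hg], Q + R, S.add_mem hQ hR, by simp [hQ0, hR0], ?_⟩
    rw [add_sub_add_comm, map_add]
    -- Polynomials in `number` commute, so `f * g` can act on each difference with the annihilating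
    -- factor first.
    nth_rewrite 1 [mul_comm f g]
    rw [map_mul, map_mul, Module.End.mul_apply, Module.End.mul_apply, hPQ, hPR]
    simp
  | smul r a _ ha =>
    obtain ⟨f, hf, Q, hQ, hQ0, hPQ⟩ := ha
    exact ⟨f, hf, r • Q, S.smul_mem hQ r, by simp [hQ0], by rw [← smul_sub, map_smul, hPQ, smul_zero]⟩
  | mem Q hQ =>
    obtain ⟨k, hk, hkS⟩ := hQ
    obtain rfl | hk0 := eq_or_ne k 0
    · exact ⟨1, by simp, Q, hkS rfl, by simpa using hk, by simp⟩
    · exact ⟨Polynomial.X - C (k : ℂ), by simpa, 0, S.zero_mem, by simp, by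
        rw [sub_zero, map_sub, Polynomial.aeval_X, Polynomial.aeval_C, LinearMap.sub_apply,
          Module.algebraMap_end_apply, hk, sub_self]⟩

/-- Closed polynomials are cohomologous to elements of a subalgebra onto which `h` contracts. -/
theorem exists_sub_b₀_mem (S : Subalgebra ℂ M.Alg)
    (hN : ∀ P ∈ LinearMap.range M.lin, h.number (h.number P) = h.number P)
    (hS : ∀ P ∈ LinearMap.range M.lin, P - h.number P ∈ S) {p : ℤ} {P : M.Alg}
    (hP : P ∈ M.ghostPart p) (hcl : M.b₀ P = 0) :
    ∃ R ∈ M.ghostPart (p - 1), P - M.b₀ R ∈ S := by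
  obtain ⟨f, hf, hPf⟩ := h.exists_aeval_number_mem S hN hS P
  -- Write `f = g X + f(0)` with `g = f.divX`. Since `b₀ P = 0` and `b₀` commutes with `g(N)`, `f(N)
  -- P = b₀ K g(N) P + f(0) P`; dividing by `f(0)` gives the witness.
  refine ⟨-(f.coeff 0)⁻¹ • h.antiderivation (Polynomial.aeval h.number f.divX P),
    Submodule.smul_mem _ _ (h.antiderivation_mem_ghostPart (h.aeval_number_mem_ghostPart _ hP)), ?_⟩
  have H : Polynomial.aeval h.number f P =
      M.b₀ (h.antiderivation (Polynomial.aeval h.number f.divX P)) + f.coeff 0 • P := by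
    conv_lhs => rw [← Polynomial.divX_mul_X_add f, mul_comm]
    rw [map_add, map_mul, Polynomial.aeval_X, LinearMap.add_apply, Module.End.mul_apply,
      number_apply, b₀_aeval_number, hcl]
    simp
  convert S.smul_mem hPf (f.coeff 0)⁻¹ using 1
  rw [H, smul_add, smul_smul, inv_mul_cancel₀ hf, map_smul, one_smul, neg_smul, sub_neg_eq_add,
    add_comm]

end Lowering

/-! ### Contractions from the linear cohomology -/

/-- Over a field the surjection from `T` to `f(T)` splits, and the splitting extends to all of `V'`.
Having `s` defined everywhere avoids maps between subspaces later. -/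
theorem exists_section {V V' : Type*} [AddCommGroup V] [Module ℂ V] [AddCommGroup V'] [Module ℂ V']
    (f : V →ₗ[ℂ] V') (T : Submodule ℂ V) :
    ∃ s : V' →ₗ[ℂ] V, ∀ u ∈ T, s (f u) ∈ T ∧ f (s (f u)) = f u := by
  obtain ⟨g, hg⟩ := (f.domRestrict T).rangeRestrict.exists_rightInverse_of_surjective
    (LinearMap.range_rangeRestrict _)
  obtain ⟨s, hs⟩ := (T.subtype ∘ₗ g).exists_extend
  refine ⟨s, fun u hu => ?_⟩
  have h := LinearMap.congr_fun hs ⟨f u, ⟨u, hu⟩, rfl⟩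
  simp only [LinearMap.comp_apply, Submodule.subtype_apply] at h
  rw [h]
  exact ⟨Submodule.coe_mem _, congrArg Subtype.val (LinearMap.congr_fun hg ⟨f u, ⟨u, hu⟩, rfl⟩)⟩

/-- If every closed linear combination of variables is cohomologous to an element of `W`, then the
linear combinations of variables contract onto elements of `W`. -/
theorem exists_lowering (W : Submodule ℂ (X →₀ ℂ))
    (hW : ∀ p, ∀ v ∈ M.linPart p, M.linOp v = 0 → ∃ u ∈ M.linPart (p - 1), v - M.linOp u ∈ W) :
    ∃ h : M.Lowering,
      (∀ P ∈ LinearMap.range M.lin, h.number (h.number P) = h.number P) ∧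
      ∀ P ∈ LinearMap.range M.lin, P - h.number P ∈ W.map M.lin := by
  -- `s p` picks primitives of coboundaries of degree `p`; `q p`, obtained next, projects cocycles
  -- to coboundaries along representatives taken in `W`.
  have hs (p : ℤ) := exists_section M.linOp (M.linPart (p - 1))
  have hq (p : ℤ) : ∃ q : (X →₀ ℂ) →ₗ[ℂ] (X →₀ ℂ),
      (∀ v ∈ M.linPart p, M.linOp v = 0 →
        (∃ u ∈ M.linPart (p - 1), q v = M.linOp u) ∧ v - q v ∈ W) ∧
      (∀ u ∈ M.linPart (p - 1), q (M.linOp u) = M.linOp u) := by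
    set B := (M.linPart (p - 1)).map M.linOp
    obtain ⟨t, ht⟩ := exists_section B.mkQ W
    refine ⟨LinearMap.id - t ∘ₗ B.mkQ, fun v hv hcl => ?_, fun u hu => ?_⟩
    · obtain ⟨u, hu, hw⟩ := hW p v hv hcl
      have e : B.mkQ v = B.mkQ (v - M.linOp u) := by
        rw [← sub_eq_zero, ← map_sub, sub_sub_cancel, Submodule.mkQ_apply,
          Submodule.Quotient.mk_eq_zero]
        exact ⟨u, hu, rfl⟩
      obtain ⟨h1, h2⟩ := ht _ hw
      rw [← e] at h1 h2
      have h3 : v - t (B.mkQ v) ∈ B := by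
        rw [← Submodule.Quotient.mk_eq_zero, ← Submodule.mkQ_apply, map_sub, h2, sub_self]
      obtain ⟨u', hu', e'⟩ := h3
      exact ⟨⟨u', hu', by simpa using e'.symm⟩, by simpa using h1⟩
    · have e : B.mkQ (M.linOp u) = 0 := by
        rw [Submodule.mkQ_apply, Submodule.Quotient.mk_eq_zero]
        exact ⟨u, hu, rfl⟩
      rw [LinearMap.sub_apply, LinearMap.comp_apply, e]
      simp
  choose s hs using hs
  choose q hq hqB using hq
  have hsd {p : ℤ} {v : X →₀ ℂ} (hv : v ∈ M.linPart p) : s (p + 1) (M.linOp v) ∈ M.linPart p ∧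
      M.linOp (s (p + 1) (M.linOp v)) = M.linOp v := by
    have h := hs (p + 1) v (by simpa using hv)
    simpa using h
  have hz {p : ℤ} {v : X →₀ ℂ} (hv : v ∈ M.linPart p) :
      v - s (p + 1) (M.linOp v) ∈ M.linPart p ∧
      M.linOp (v - s (p + 1) (M.linOp v)) = 0 :=
    ⟨Submodule.sub_mem _ hv (hsd hv).1, by rw [map_sub, (hsd hv).2, sub_self]⟩
  have hsq {p : ℤ} {v : X →₀ ℂ} (hv : v ∈ M.linPart p) :
      s p (q p (v - s (p + 1) (M.linOp v))) ∈ M.linPart (p - 1) ∧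
      M.linOp (s p (q p (v - s (p + 1) (M.linOp v)))) = q p (v - s (p + 1) (M.linOp v)) := by
    obtain ⟨u, hu, e⟩ := (hq p _ (hz hv).1 (hz hv).2).1
    rw [e]
    exact hs p u hu
  -- Three maps in succession: `1 - s d` projects to cocycles, `q` to coboundaries, and `s` takes a
  -- primitive.
  let h : M.Lowering :=
    { op := fun x => s (M.gh x) (q (M.gh x)
        (Finsupp.single x 1 - s (M.gh x + 1) (M.linOp (Finsupp.single x 1))))
      op_mem := fun x => (hsq (M.single_mem_linPart x)).1 }
  have hop {p : ℤ} {v : X →₀ ℂ} (hv : v ∈ M.linPart p) :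
      h.linOp v = s p (q p (v - s (p + 1) (M.linOp v))) := by
    have H := map_mem_of_single (T := ⊥)
      (g := h.linOp - s p ∘ₗ q p ∘ₗ (LinearMap.id - s (p + 1) ∘ₗ M.linOp)) (fun x hx => ?_) hv
    · simpa [sub_eq_zero] using H
    · rw [← show M.gh x = p from hx]
      simp [Lowering.linOp, h]
  set n := M.linOp ∘ₗ h.linOp + h.linOp ∘ₗ M.linOp with hn
  -- With `z = v - s d v` the cocycle part, `n v = q z + s d v`. Hence `v - n v = z - q z` lies in
  -- `W`.
  have hnv {p : ℤ} {v : X →₀ ℂ} (hv : v ∈ M.linPart p) :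
      n v = q p (v - s (p + 1) (M.linOp v)) + s (p + 1) (M.linOp v) := by
    have e : q (p + 1) (M.linOp v) = M.linOp v := hqB (p + 1) v (by simpa using hv)
    rw [hn, LinearMap.add_apply, LinearMap.comp_apply, LinearMap.comp_apply, hop hv, (hsq hv).2,
      hop (M.linOp_mem hv), linOp_linOp, map_zero, sub_zero, e]
  have hqmem {p : ℤ} {v : X →₀ ℂ} (hv : v ∈ M.linPart p) :
      q p (v - s (p + 1) (M.linOp v)) ∈ M.linPart p ∧
      M.linOp (q p (v - s (p + 1) (M.linOp v))) = 0 := by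
    obtain ⟨u, hu, e⟩ := (hq p _ (hz hv).1 (hz hv).2).1
    rw [e]
    exact ⟨by simpa using M.linOp_mem hu, M.linOp_linOp u⟩
  have hqq {p : ℤ} {v : X →₀ ℂ} (hv : v ∈ M.linPart p) :
      q p (q p (v - s (p + 1) (M.linOp v))) = q p (v - s (p + 1) (M.linOp v)) := by
    obtain ⟨u, hu, e⟩ := (hq p _ (hz hv).1 (hz hv).2).1
    rw [e, hqB p u hu]
  -- `n v` and `v` have the same differential, and `q` fixes coboundaries, so applying `n` again
  -- changes nothing.
  have hnn : n ∘ₗ n = n := by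
    ext1 x
    ext1
    have hv := M.single_mem_linPart x
    have hv' : n (Finsupp.single x 1) ∈ M.linPart (M.gh x) := by
      rw [hnv hv]
      exact Submodule.add_mem _ (hqmem hv).1 (hsd hv).1
    have hd : M.linOp (n (Finsupp.single x 1)) = M.linOp (Finsupp.single x 1) := by
      rw [hnv hv, map_add, (hqmem hv).2, (hsd hv).2, zero_add]
    simp only [LinearMap.comp_apply, Finsupp.lsingle_apply]
    rw [hnv hv', hd, hnv hv, add_sub_cancel_right, hqq hv]
  have hnW (v : X →₀ ℂ) : v - n v ∈ W := by
    refine map_mem_of_single (s := Set.univ) (g := LinearMap.id - n) (fun x _ => ?_)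
      (by simp [Finsupp.supported_univ])
    have hv := M.single_mem_linPart x
    have := (hq _ _ (hz hv).1 (hz hv).2).2
    rw [LinearMap.sub_apply, hnv hv]
    convert this using 1
    simp [sub_sub, add_comm]
  have hN (v : X →₀ ℂ) : h.number (M.lin v) = M.lin (n v) := h.number_lin v
  refine ⟨h, ?_, ?_⟩
  · rintro _ ⟨v, rfl⟩
    rw [hN, hN, ← LinearMap.comp_apply n n, hnn]
  · rintro _ ⟨v, rfl⟩
    exact ⟨v - n v, hnW v, by rw [map_sub, hN]⟩

/-- On forms `b₀` acts componentwise, so a correction can be chosen separately for each component.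
-/
theorem exists_cohomologous (W : Submodule ℂ (X →₀ ℂ))
    (hW : ∀ p, ∀ v ∈ M.linPart p, M.linOp v = 0 → ∃ u ∈ M.linPart (p - 1), v - M.linOp u ∈ W)
    (S : Subalgebra ℂ M.Alg) (hS : ∀ v ∈ W, M.lin v ∈ S) (p : ℤ) (q : ℕ) (x : M.Cohomology p q) :
    ∃ ω : M.cocycles p q, (∀ I, ω.1 I ∈ S) ∧ M.cls ω = x := by
  obtain ⟨h, hN, hh⟩ := M.exists_lowering W hW
  have hh' : ∀ P ∈ LinearMap.range M.lin, P - h.number P ∈ S := fun P hP => by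
    obtain ⟨v, hv, e⟩ := hh P hP
    exact e ▸ hS v hv
  obtain ⟨⟨ω, hω, hcl⟩, rfl⟩ := Submodule.Quotient.mk_surjective _ x
  have H (I) := h.exists_sub_b₀_mem S hN hh' (hω I trivial) (congrFun hcl I)
  choose R hR hRS using H
  have hmem : M.b₀Form q R ∈ M.coboundaries p q := ⟨R, fun I _ => hR I, rfl⟩
  refine ⟨⟨ω - M.b₀Form q R, Submodule.sub_mem _ ⟨hω, hcl⟩ (M.coboundaries_le_cocycles p q hmem)⟩,
    hRS, ?_⟩
  refine (Submodule.Quotient.eq _).2 ?_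
  rw [Submodule.submoduleOf, Submodule.mem_comap]
  simpa using hmem

end LinearModel

/-! ### Exactness of Koszul complexes in three variables -/

section Koszul

open MvPolynomial

/-- Applied to the coefficient of `c`: the constant is the undifferentiated ghost, and the rest is a
combination of derivatives of `c`, hence exact. -/
theorem exists_eq_C_add_sum (P : MvPolynomial (Fin 3) ℂ) :
    ∃ (r : ℂ) (Q : Fin 3 → MvPolynomial (Fin 3) ℂ), P = C r + ∑ μ, X μ * Q μ := by
  induction P using MvPolynomial.induction_on with
  | C r => exact ⟨r, 0, by simp⟩
  | add P P' h h' =>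
    obtain ⟨r, Q, rfl⟩ := h
    obtain ⟨r', Q', rfl⟩ := h'
    refine ⟨r + r', Q + Q', ?_⟩
    simp only [map_add, Pi.add_apply, mul_add, Finset.sum_add_distrib]
    ring
  | mul_X P μ _ => exact ⟨0, Pi.single μ P, by simp [Pi.single_apply, mul_comm]⟩

/-- Setting the variable `X i` to zero changes a polynomial by a multiple of `X i`. -/
theorem X_dvd_sub_aeval_update {σ : Type*} [DecidableEq σ] (i : σ) (P : MvPolynomial σ ℂ) :
    X i ∣ P - aeval (Function.update (X : σ → MvPolynomial σ ℂ) i 0) P := by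
  induction P using MvPolynomial.induction_on with
  | C r => simp
  | add P P' h h' => simpa [add_sub_add_comm] using dvd_add h h'
  | mul_X P j h =>
    obtain rfl | hj := eq_or_ne j i
    · simp
    · simpa [Function.update_of_ne hj, ← sub_mul] using h.mul_right (X j)

/-- Koszul exactness in two variables: `X j` is prime and does not divide `X i`. -/
theorem exists_of_mul_X_add_mul_X {σ : Type*} {i j : σ} (hij : i ≠ j) {p q : MvPolynomial σ ℂ}
    (h : p * X i + q * X j = 0) : ∃ t, p = X j * t ∧ q = -(X i * t) := by
  obtain ⟨t, rfl⟩ : X j ∣ p := by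
    refine ((X_prime (i := j)).dvd_or_dvd (b := X i) ⟨-q, by linear_combination h⟩).resolve_right ?_
    rw [X_dvd_X]
    exact hij.symm
  refine ⟨t, rfl, ?_⟩
  have h' : X j * (q + X i * t) = 0 := by linear_combination h
  exact eq_neg_of_add_eq_zero_left ((mul_eq_zero.1 h').resolve_left (X_ne_zero j))

/-- Exactness of the Koszul complex in the degree of divergence-free vectors. -/
theorem exists_of_sum_X_mul_eq_zero {P : Fin 3 → MvPolynomial (Fin 3) ℂ}
    (h : ∑ μ, X μ * P μ = 0) :
    ∃ t a b, P 0 = X 1 * t + X 2 * a ∧ P 1 = -(X 0 * t) + X 2 * b ∧ P 2 = -(X 0 * a) - X 1 * b := by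
  rw [Fin.sum_univ_three] at h
  -- Setting `X 2 = 0` reduces to two variables; the errors in `P 0` and `P 1` are multiples of `X
  -- 2`, and `P 2` follows by cancelling `X 2`.
  have h' := congrArg (aeval (Function.update (X : Fin 3 → MvPolynomial (Fin 3) ℂ) 2 0)) h
  simp only [map_add, map_mul, aeval_X, map_zero, Function.update_self, zero_mul, add_zero,
    Function.update_of_ne (show (0 : Fin 3) ≠ 2 by decide),
    Function.update_of_ne (show (1 : Fin 3) ≠ 2 by decide)] at h'
  rw [mul_comm (X 0), mul_comm (X 1)] at h'
  obtain ⟨t, h0, h1⟩ := exists_of_mul_X_add_mul_X (i := (0 : Fin 3)) (j := 1) (by decide) h'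
  obtain ⟨a, ha⟩ := X_dvd_sub_aeval_update 2 (P 0)
  obtain ⟨b, hb⟩ := X_dvd_sub_aeval_update 2 (P 1)
  rw [h0] at ha
  rw [h1] at hb
  refine ⟨t, a, b, by linear_combination ha, by linear_combination hb, ?_⟩
  refine mul_left_cancel₀ (X_ne_zero (2 : Fin 3)) ?_
  linear_combination h - X 0 * ha - X 1 * hb

/-- The cross product with the vector of variables, the symbol of the curl. -/
noncomputable def symbolCurl (P : Fin 3 → MvPolynomial (Fin 3) ℂ) (k : Fin 3) :
    MvPolynomial (Fin 3) ℂ :=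
  X (k + 2) * P (k + 1) - X (k + 1) * P (k + 2)

/-- Exactness of the Koszul complex in the degree of curl-free vectors. -/
theorem exists_of_symbolCurl_eq_zero {P : Fin 3 → MvPolynomial (Fin 3) ℂ}
    (h : ∀ k, symbolCurl P k = 0) : ∃ t, ∀ μ, P μ = X μ * t := by
  have h1 := h 1
  have h2 := h 2
  simp only [symbolCurl, Fin.isValue, Fin.reduceAdd] at h1 h2
  -- One component of the curl already gives `t` for `P 0` and `P 1`; another, after cancelling `X
  -- 0`, gives `P 2`.
  obtain ⟨t, ht, h1'⟩ := exists_of_mul_X_add_mul_X (p := P 0) (q := -P 1) (i := (1 : Fin 3)) (j := 0)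
    (by decide) (by linear_combination h2)
  refine ⟨t, fun μ => ?_⟩
  fin_cases μ
  · exact ht
  · exact neg_injective h1'
  · refine mul_left_cancel₀ (X_ne_zero (0 : Fin 3)) ?_
    simp only [Fin.reduceFinMk]
    linear_combination h1 + X 2 * ht

/-- The values at the origin and at a unit vector are `-r` and `1 - r`. The subtracted constant can
be arbitrary, which is why `m` needs no restriction. -/
theorem laplace_sub_ne_zero (r : ℂ) :
    (X 0 * X 0 + X 1 * X 1 + X 2 * X 2 - C r : MvPolynomial (Fin 3) ℂ) ≠ 0 := by
  intro h
  have h0 := congrArg (eval 0) h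
  have h1 := congrArg (eval (Pi.single 0 1)) h
  simp at h0 h1
  simp [h0] at h1

/-- If `∑ μ, (x μ)(∂) ΩA_μ + (y μ)(∂) ΩB_μ` is closed, then `x` is a gradient and `y = 0`. -/
theorem exists_of_source_closed (m : ℂ) {x y : Fin 3 → MvPolynomial (Fin 3) ℂ}
    (hB : ∀ k, C Complex.I * symbolCurl x k + 2 * y k = 0)
    (hA : ∀ k, C (Complex.I * m) * symbolCurl x k + C Complex.I * symbolCurl y k = 0) :
    (∃ t, ∀ μ, x μ = X μ * t) ∧ ∀ μ, y μ = 0 := by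
  have hI : (C Complex.I * C Complex.I : MvPolynomial (Fin 3) ℂ) = -1 := by
    rw [← C_mul, Complex.I_mul_I]; simp
  have hz (k) : symbolCurl x k = 2 * C Complex.I * y k := by
    linear_combination (-C Complex.I) * hB k + symbolCurl x k * hI
  have hc (k) : symbolCurl y k = -2 * C Complex.I * C m * y k := by
    have := hA k
    rw [hz, C_mul] at this
    linear_combination (-C Complex.I) * this + (symbolCurl y k + 2 * C Complex.I * C m * y k) * hI
  -- By `hz`, `y` is a multiple of a curl, hence divergence-free.
  have hdiv : X 0 * y 0 + X 1 * y 1 + X 2 * y 2 = 0 := by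
    have h0 := hz 0
    have h1 := hz 1
    have h2 := hz 2
    simp only [symbolCurl, Fin.isValue, Fin.reduceAdd, zero_add] at h0 h1 h2
    have h2I : (2 * C Complex.I : MvPolynomial (Fin 3) ℂ) ≠ 0 := by
      intro h
      have h' : (2 : MvPolynomial (Fin 3) ℂ) = 0 := by
        linear_combination (-C Complex.I) * h + 2 * hI
      exact two_ne_zero h'
    refine (mul_eq_zero.1 ?_ : (2 * C Complex.I : MvPolynomial (Fin 3) ℂ) = 0 ∨ _).resolve_left h2I
    linear_combination - X 0 * h0 - X 1 * h1 - X 2 * h2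
  -- Apply the curl twice: for divergence-free `y` this is minus the Laplacian symbol times `y`,
  -- while `hc` makes it `-4 m² y`.
  have hy (k) : y k = 0 := by
    refine (mul_eq_zero.1 ?_).resolve_left (laplace_sub_ne_zero (4 * m * m))
    have h0 := hc 0
    have h1 := hc 1
    have h2 := hc 2
    simp only [symbolCurl, Fin.isValue, Fin.reduceAdd, zero_add] at h0 h1 h2
    simp only [C_mul, map_ofNat]
    fin_cases k <;> simp only [Fin.reduceFinMk]
    · linear_combination X 0 * hdiv - X 2 * h1 + X 1 * h2 + 2 * C Complex.I * C m * h0 -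
        4 * C m * C m * y 0 * hI
    · linear_combination X 1 * hdiv - X 0 * h2 + X 2 * h0 + 2 * C Complex.I * C m * h1 -
        4 * C m * C m * y 1 * hI
    · linear_combination X 2 * hdiv - X 1 * h0 + X 0 * h1 + 2 * C Complex.I * C m * h2 -
        4 * C m * C m * y 2 * hI
  refine ⟨exists_of_symbolCurl_eq_zero fun k => by rw [hz, hy, mul_zero], hy⟩

end Koszul

/-! ### Jet variables as polynomials in the derivatives -/

section Jets

open MvPolynomial

variable {F ι : Type*}

/-- The linear combination `P(∂) f^a` of jet variables. -/
noncomputable def jetPoly (f : F) (a : ι) : MvPolynomial (Fin 3) ℂ →ₗ[ℂ] (Jet F ι →₀ ℂ) :=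
  (basisMonomials (Fin 3) ℂ).constr ℂ (jet f a)

@[simp] theorem jetPoly_monomial (f : F) (a : ι) (α : Fin 3 →₀ ℕ) :
    jetPoly f a (monomial α 1) = jet f a α :=
  (basisMonomials (Fin 3) ℂ).constr_basis ℂ (jet f a) α

theorem X_mul_monomial (α : Fin 3 →₀ ℕ) (μ : Fin 3) :
    (X μ * monomial α 1 : MvPolynomial (Fin 3) ℂ) = monomial (up α μ) 1 := by
  rw [X, monomial_mul, one_mul, up, add_comm]

theorem jetPoly_X_mul_monomial (f : F) (a : ι) (α : Fin 3 →₀ ℕ) (μ : Fin 3) :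
    jetPoly f a (X μ * monomial α 1) = jet f a (up α μ) := by
  rw [X_mul_monomial, jetPoly_monomial]

theorem jetPoly_mem {s : Set (Jet F ι)} {f : F} {a : ι} (h : ∀ α, (f, a, α) ∈ s)
    (P : MvPolynomial (Fin 3) ℂ) : jetPoly f a P ∈ Finsupp.supported ℂ ℂ s := by
  induction P using MvPolynomial.induction_on' with
  | monomial α r =>
    rw [← mul_one r, ← smul_eq_mul, map_smul, map_smul, jetPoly_monomial]
    exact Submodule.smul_mem _ _ (jet_mem (h α))
  | add P Q hP hQ => rw [map_add]; exact Submodule.add_mem _ hP hQ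

open Classical in
/-- The polynomial `P` for which `P(∂) f^a` occurs in a linear combination of jet variables. -/
noncomputable def coord (f : F) (a : ι) : (Jet F ι →₀ ℂ) →ₗ[ℂ] MvPolynomial (Fin 3) ℂ :=
  Finsupp.linearCombination ℂ fun x => if x.1 = f ∧ x.2.1 = a then monomial x.2.2 1 else 0

open Classical in
-- Reading off coefficients in this way turns the closure of a linear combination into polynomial
-- equations.
theorem coord_jetPoly (f g : F) (a : ι) (P : MvPolynomial (Fin 3) ℂ) :
    coord f a (jetPoly g a P) = if g = f then P else 0 := by
  have h : coord f a ∘ₗ jetPoly g a = if g = f then LinearMap.id else 0 := by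
    refine (basisMonomials (Fin 3) ℂ).ext fun α => ?_
    split_ifs with hgf <;> simp [coord, jet, hgf]
  rw [← LinearMap.comp_apply, h]
  split_ifs <;> rfl

theorem exists_eq_sum_jetPoly {κ : Type*} [Fintype κ] (e : κ → F) (a : ι) {v : Jet F ι →₀ ℂ}
    (hv : v ∈ Finsupp.supported ℂ ℂ {x : Jet F ι | x.1 ∈ Set.range e ∧ x.2.1 = a}) :
    ∃ P : κ → MvPolynomial (Fin 3) ℂ, v = ∑ k, jetPoly (e k) a (P k) := by
  classical
  have h := LinearModel.map_mem_of_single (g := LinearMap.id)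
    (T := LinearMap.range (∑ k, jetPoly (e k) a ∘ₗ LinearMap.proj k)) (fun x hx => ?_) hv
  · obtain ⟨P, hP⟩ := h
    exact ⟨P, by simpa using hP.symm⟩
  · obtain ⟨f, a', α⟩ := x
    obtain ⟨⟨k, rfl⟩, rfl⟩ := hx
    refine ⟨Pi.single k (monomial α 1), ?_⟩
    simp [Pi.single_apply, apply_ite, jet]

/-- For an operator which preserves the index `a`, cohomology may be computed for each `a`. -/
theorem LinearModel.linear_cohomology_of_index (M : LinearModel (Jet F ι))
    (hM : ∀ x, M.op x ∈ Finsupp.supported ℂ ℂ {y : Jet F ι | y.2.1 = x.2.1})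
    (W : Submodule ℂ (Jet F ι →₀ ℂ)) (p : ℤ)
    (h : ∀ a, ∀ v ∈ Finsupp.supported ℂ ℂ {x : Jet F ι | M.gh x = p ∧ x.2.1 = a},
      M.linOp v = 0 → ∃ u ∈ M.linPart (p - 1), v - M.linOp u ∈ W)
    {v : Jet F ι →₀ ℂ} (hv : v ∈ M.linPart p) (hcl : M.linOp v = 0) :
    ∃ u ∈ M.linPart (p - 1), v - M.linOp u ∈ W := by
  classical
  -- The projection onto the jets of index `a`. It commutes with the differential, and `v` is the
  -- sum of its projections over the finitely many indices in its support.
  let r (a : ι) : (Jet F ι →₀ ℂ) →ₗ[ℂ] (Jet F ι →₀ ℂ) :=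
    Finsupp.linearCombination ℂ fun x => if x.2.1 = a then Finsupp.single x 1 else 0
  have hr_self (a : ι) {w : Jet F ι →₀ ℂ} (hw : w ∈ Finsupp.supported ℂ ℂ {y | y.2.1 = a}) :
      r a w = w := by
    have h := map_mem_of_single (T := ⊥) (g := r a - LinearMap.id) (fun x hx => ?_) hw
    · simpa [sub_eq_zero] using h
    · simp [r, show x.2.1 = a from hx]
  have hr_zero {a b : ι} (hab : b ≠ a) {w : Jet F ι →₀ ℂ}
      (hw : w ∈ Finsupp.supported ℂ ℂ {y | y.2.1 = b}) : r a w = 0 :=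
    map_mem_of_single (T := ⊥) (fun x hx => by simp [r, show x.2.1 = b from hx, hab]) hw
  have hrd (a : ι) (v : Jet F ι →₀ ℂ) : M.linOp (r a v) = r a (M.linOp v) := by
    have h : M.linOp ∘ₗ r a = r a ∘ₗ M.linOp := by
      ext1 x
      ext1
      by_cases hx : x.2.1 = a
      · have h0 := hr_self a (hx ▸ hM x)
        simp only [r] at h0
        simp [linOp, r, hx, h0]
      · have h0 := hr_zero hx (hM x)
        simp only [r] at h0
        simp [linOp, r, hx, h0]
    exact LinearMap.congr_fun h v
  have hsum : v = ∑ a ∈ v.support.image fun x => x.2.1, r a v := by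
    have h := map_mem_of_single (T := ⊥) (s := v.support)
      (g := LinearMap.id - ∑ a ∈ v.support.image fun x => x.2.1, r a) (fun x hx => ?_)
      ((Finsupp.mem_supported ℂ v).2 subset_rfl)
    · simpa [sub_eq_zero] using h
    · have hx' : x.2.1 ∈ v.support.image fun x => x.2.1 := Finset.mem_image_of_mem _ hx
      simp only [r, LinearMap.sub_apply, LinearMap.id_apply, LinearMap.sum_apply,
        Finsupp.linearCombination_single, one_smul, Finset.sum_ite_eq, if_pos hx', sub_self]
      exact Submodule.zero_mem _
  have hmem (a : ι) : r a v ∈ Finsupp.supported ℂ ℂ {x : Jet F ι | M.gh x = p ∧ x.2.1 = a} := by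
    refine map_mem_of_single (fun x hx => ?_) hv
    by_cases hxa : x.2.1 = a
    · simp only [r, Finsupp.linearCombination_single, if_pos hxa, one_smul]
      exact Finsupp.single_mem_supported ℂ (1 : ℂ) ⟨hx, hxa⟩
    · simp [r, hxa]
  have H (a : ι) := h a (r a v) (hmem a) (by rw [hrd, hcl, map_zero])
  choose u hu huW using H
  refine ⟨∑ a ∈ v.support.image fun x => x.2.1, u a, Submodule.sum_mem _ fun a _ => hu a, ?_⟩
  conv in v - _ => lhs; rw [hsum]
  rw [map_sum, ← Finset.sum_sub_distrib]
  exact Submodule.sum_mem _ fun a _ => huW a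

/-- The linear span of `dA` and its derivatives, the undifferentiated `c`, and `B` and its
derivatives. -/
noncomputable def depSpan (A B : Fin 3 → F) (c : F) : Submodule ℂ (Jet F ι →₀ ℂ) :=
  Submodule.span ℂ ({v | ∃ μ ν a α, v = extd A μ ν a α} ∪ {v | ∃ a, v = jet c a 0} ∪
    {v | ∃ μ a α, v = jet (B μ) a α})

variable (A B : Fin 3 → F) (c : F)

theorem lin_mem_depAlg (M : LinearModel (Jet F ι)) {v : Jet F ι →₀ ℂ} (hv : v ∈ depSpan A B c) :
    M.lin v ∈ depAlg M A B c := by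
  induction hv using Submodule.span_induction with
  | zero => simp
  | add _ _ _ _ h h' => rw [map_add]; exact add_mem h h'
  | smul r _ _ h => rw [map_smul]; exact Subalgebra.smul_mem _ h r
  | mem v h =>
    refine Algebra.subset_adjoin ?_
    rcases h with (⟨μ, ν, a, α, rfl⟩ | ⟨a, rfl⟩) | ⟨μ, a, α, rfl⟩
    · exact Or.inl (Or.inl ⟨μ, ν, a, α, rfl⟩)
    · exact Or.inl (Or.inr ⟨a, by simp [LinearModel.lin, jet]⟩)
    · exact Or.inr ⟨μ, a, α, by simp [LinearModel.lin, jet]⟩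

theorem map_mem_of_monomial {V : Type*} [AddCommGroup V] [Module ℂ V] {T : Submodule ℂ V}
    (g : MvPolynomial (Fin 3) ℂ →ₗ[ℂ] V) (h : ∀ α, g (monomial α 1) ∈ T)
    (P : MvPolynomial (Fin 3) ℂ) : g P ∈ T := by
  induction P using MvPolynomial.induction_on' with
  | monomial α r =>
    rw [← mul_one r, ← smul_eq_mul, map_smul, map_smul]
    exact Submodule.smul_mem _ _ (h α)
  | add P Q hP hQ => rw [map_add]; exact Submodule.add_mem _ hP hQ

theorem jetPoly_B_mem_depSpan (μ : Fin 3) (a : ι) (P : MvPolynomial (Fin 3) ℂ) :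
    jetPoly (B μ) a P ∈ depSpan A B c :=
  map_mem_of_monomial (T := depSpan A B c) _ (fun α => Submodule.subset_span (Or.inr ⟨μ, a, α, by simp⟩)) P

theorem jetPoly_c_mem_depSpan (a : ι) (r : ℂ) : jetPoly c a (C r) ∈ depSpan A B c := by
  rw [C_apply, ← mul_one r, ← smul_eq_mul, map_smul, map_smul]
  exact Submodule.smul_mem _ _ (Submodule.subset_span (Or.inl (Or.inr ⟨a, jetPoly_monomial c a 0⟩)))

theorem jetPoly_curl_mem_depSpan (μ ν : Fin 3) (a : ι) (P : MvPolynomial (Fin 3) ℂ) :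
    jetPoly (A ν) a (X μ * P) - jetPoly (A μ) a (X ν * P) ∈ depSpan A B c :=
  map_mem_of_monomial (jetPoly (A ν) a ∘ₗ LinearMap.mulLeft ℂ (X μ) -
    jetPoly (A μ) a ∘ₗ LinearMap.mulLeft ℂ (X ν)) (fun α => Submodule.subset_span
      (Or.inl (Or.inl ⟨μ, ν, a, α, by simp [jetPoly_X_mul_monomial, extd]⟩))) P

/-- A divergence-free vector of coefficients is a curl, so the combination of the `A μ` regroups
into antisymmetrized derivatives. -/
theorem sum_jetPoly_mem_depSpan (a : ι) {P : Fin 3 → MvPolynomial (Fin 3) ℂ}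
    (h : ∑ μ, X μ * P μ = 0) : ∑ μ, jetPoly (A μ) a (P μ) ∈ depSpan A B c := by
  obtain ⟨t, u, w, h0, h1, h2⟩ := exists_of_sum_X_mul_eq_zero h
  have H := Submodule.add_mem _ (Submodule.add_mem _ (jetPoly_curl_mem_depSpan A B c 1 0 a t)
    (jetPoly_curl_mem_depSpan A B c 2 0 a u)) (jetPoly_curl_mem_depSpan A B c 2 1 a w)
  convert H using 1
  rw [Fin.sum_univ_three, h0, h1, h2]
  simp only [map_add, map_sub, map_neg]
  abel

end Jets

open MvPolynomial

theorem ext_monomial {V : Type*} [AddCommGroup V] [Module ℂ V]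
    {g g' : MvPolynomial (Fin 3) ℂ →ₗ[ℂ] V} (h : ∀ α, g (monomial α 1) = g' (monomial α 1))
    (P : MvPolynomial (Fin 3) ℂ) : g P = g' P :=
  LinearMap.congr_fun ((basisMonomials (Fin 3) ℂ).ext h) P

theorem C_two : (C 2 : MvPolynomial (Fin 3) ℂ) = 2 := map_ofNat C 2

section Operators

variable {F ι : Type*}

/-- `P(∂) (* dV^a)_μ`. -/
noncomputable def starDPoly (V : Fin 3 → F) (μ : Fin 3) (a : ι) :
    MvPolynomial (Fin 3) ℂ →ₗ[ℂ] (Jet F ι →₀ ℂ) :=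
  jetPoly (V (μ + 2)) a ∘ₗ LinearMap.mulLeft ℂ (X (μ + 1)) -
    jetPoly (V (μ + 1)) a ∘ₗ LinearMap.mulLeft ℂ (X (μ + 2))

@[simp] theorem starDPoly_apply (V : Fin 3 → F) (μ : Fin 3) (a : ι) (P : MvPolynomial (Fin 3) ℂ) :
    starDPoly V μ a P =
      jetPoly (V (μ + 2)) a (X (μ + 1) * P) - jetPoly (V (μ + 1)) a (X (μ + 2) * P) := rfl

theorem starDPoly_monomial (V : Fin 3 → F) (μ : Fin 3) (a : ι) (α : Fin 3 →₀ ℕ) :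
    starDPoly V μ a (monomial α 1) = starD V μ a α := by
  simp [jetPoly_X_mul_monomial, starD, extd]

theorem extd_mem_index (V : Fin 3 → F) (μ ν : Fin 3) (a : ι) (α : Fin 3 →₀ ℕ) :
    extd V μ ν a α ∈ Finsupp.supported ℂ ℂ {y : Jet F ι | y.2.1 = a} :=
  extd_mem (fun _ _ => rfl) _ _ _

end Operators

/-! ### Linear cohomology of the gaussian model -/

section Gaussian

open GaussField

variable {ι : Type*} (m : ℂ)

theorem gaussian_linOp_jet (f : GaussField) (a : ι) (α : Fin 3 →₀ ℕ) :
    (gaussian ι m).linOp (jet f a α) = GaussField.op m (f, a, α) := by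
  simp [LinearModel.linOp, jet, gaussian]

theorem gaussian_linOp_A (μ : Fin 3) (a : ι) (P : MvPolynomial (Fin 3) ℂ) :
    (gaussian ι m).linOp (jetPoly (A μ) a P) = -jetPoly c a (X μ * P) :=
  ext_monomial (g := (gaussian ι m).linOp ∘ₗ jetPoly (A μ) a)
    (g' := -(jetPoly c a ∘ₗ LinearMap.mulLeft ℂ (X μ)))
    (fun α => by simp [gaussian_linOp_jet, jetPoly_X_mul_monomial, GaussField.op]) P

theorem gaussian_linOp_B (μ : Fin 3) (a : ι) (P : MvPolynomial (Fin 3) ℂ) :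
    (gaussian ι m).linOp (jetPoly (B μ) a P) = 0 :=
  ext_monomial (g := (gaussian ι m).linOp ∘ₗ jetPoly (B μ) a) (g' := 0)
    (fun α => by simp [gaussian_linOp_jet, GaussField.op]) P

theorem gaussian_linOp_ΩA (μ : Fin 3) (a : ι) (P : MvPolynomial (Fin 3) ℂ) :
    (gaussian ι m).linOp (jetPoly (ΩA μ) a P) =
      Complex.I • starDPoly B μ a P + (Complex.I * m) • starDPoly A μ a P :=
  ext_monomial (g := (gaussian ι m).linOp ∘ₗ jetPoly (ΩA μ) a)
    (g' := Complex.I • starDPoly B μ a + (Complex.I * m) • starDPoly A μ a)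
    (fun α => by simp [-starDPoly_apply, starDPoly_monomial, gaussian_linOp_jet, GaussField.op]) P

theorem gaussian_linOp_ΩB (μ : Fin 3) (a : ι) (P : MvPolynomial (Fin 3) ℂ) :
    (gaussian ι m).linOp (jetPoly (ΩB μ) a P) =
      Complex.I • starDPoly A μ a P + (2 : ℂ) • jetPoly (B μ) a P :=
  ext_monomial (g := (gaussian ι m).linOp ∘ₗ jetPoly (ΩB μ) a)
    (g' := Complex.I • starDPoly A μ a + (2 : ℂ) • jetPoly (B μ) a)
    (fun α => by simp [-starDPoly_apply, starDPoly_monomial, gaussian_linOp_jet, GaussField.op]) P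

theorem gaussian_linOp_Ωc (a : ι) (P : MvPolynomial (Fin 3) ℂ) :
    (gaussian ι m).linOp (jetPoly Ωc a P) = ∑ μ, jetPoly (ΩA μ) a (X μ * P) :=
  (ext_monomial (g := (gaussian ι m).linOp ∘ₗ jetPoly Ωc a)
    (g' := ∑ μ, jetPoly (ΩA μ) a ∘ₗ LinearMap.mulLeft ℂ (X μ))
    (fun α => by simp [gaussian_linOp_jet, jetPoly_X_mul_monomial, GaussField.op, dDag]) P).trans
    (by simp)

theorem gaussian_op_mem_index (x : Jet GaussField ι) :
    (gaussian ι m).op x ∈ Finsupp.supported ℂ ℂ {y : Jet GaussField ι | y.2.1 = x.2.1} := by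
  obtain ⟨_ | _ | _ | _ | _ | _, a, α⟩ := x
  · exact Submodule.neg_mem _ (jet_mem rfl)
  · exact Submodule.zero_mem _
  · exact Submodule.zero_mem _
  · exact Submodule.add_mem _ (Submodule.smul_mem _ _ (extd_mem_index _ _ _ _ _))
      (Submodule.smul_mem _ _ (extd_mem_index _ _ _ _ _))
  · exact Submodule.add_mem _ (Submodule.smul_mem _ _ (extd_mem_index _ _ _ _ _))
      (Submodule.smul_mem _ _ (jet_mem rfl))
  · exact dDag_mem (fun _ _ => rfl) _

theorem gaussian_jetPoly_mem {p : ℤ} {f : GaussField} (hf : f.gh = p) (a : ι)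
    (P : MvPolynomial (Fin 3) ℂ) : jetPoly f a P ∈ (gaussian ι m).linPart p :=
  jetPoly_mem (fun _ => hf) P

/-- The elements of ghost number `p` are combinations of a family exhausting the fields of ghost
number `p`. -/
theorem gaussian_eq_sum {κ : Type*} [Fintype κ] (e : κ → GaussField) {p : ℤ}
    (he : ∀ f : GaussField, f.gh = p → f ∈ Set.range e) {a : ι} {v : Jet GaussField ι →₀ ℂ}
    (hv : v ∈ Finsupp.supported ℂ ℂ {x | (gaussian ι m).gh x = p ∧ x.2.1 = a}) :
    ∃ P : κ → MvPolynomial (Fin 3) ℂ, v = ∑ k, jetPoly (e k) a (P k) :=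
  have h : {x : Jet GaussField ι | (gaussian ι m).gh x = p ∧ x.2.1 = a} ⊆
      {x | x.1 ∈ Set.range e ∧ x.2.1 = a} := fun x hx => ⟨he x.1 hx.1, hx.2⟩
  exists_eq_sum_jetPoly e a (Finsupp.supported_mono h hv)

/-- Ghost number `1` leaves only constant coefficients of `c`; in ghost number `0` cocycles already
lie in the span; in negative ghost number every cocycle is exact. -/
theorem gaussian_linear_cohomology (p : ℤ) {v : Jet GaussField ι →₀ ℂ}
    (hv : v ∈ (gaussian ι m).linPart p) (hcl : (gaussian ι m).linOp v = 0) :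
    ∃ u ∈ (gaussian ι m).linPart (p - 1), v - (gaussian ι m).linOp u ∈ depSpan A B c := by
  refine LinearModel.linear_cohomology_of_index _ (gaussian_op_mem_index m) _ p
    (fun a v hv hcl => ?_) hv hcl
  by_cases h1 : p = 1
  · subst h1
    obtain ⟨P, rfl⟩ := gaussian_eq_sum m (fun _ : Unit => c)
      (by rintro (_ | _ | _ | _ | _ | _) hf <;> simp_all [GaussField.gh]) hv
    obtain ⟨r, Q, hQ⟩ := exists_eq_C_add_sum (P ())
    refine ⟨-∑ μ, jetPoly (A μ) a (Q μ), Submodule.neg_mem _ (Submodule.sum_mem _ fun μ _ =>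
      gaussian_jetPoly_mem m rfl a _), ?_⟩
    simpa [hQ, gaussian_linOp_A] using jetPoly_c_mem_depSpan A B c a r
  by_cases h0 : p = 0
  · subst h0
    obtain ⟨P, rfl⟩ := gaussian_eq_sum m (Sum.elim A B)
      (by rintro (_ | _ | _ | _ | _ | _) hf <;> simp_all [GaussField.gh]) hv
    refine ⟨0, Submodule.zero_mem _, ?_⟩
    -- The coefficient of `c` says that the coefficients of `A` are divergence-free.
    have h := congrArg (coord c a) hcl
    simp [gaussian_linOp_A, gaussian_linOp_B, coord_jetPoly] at h
    simp only [Fintype.sum_sum_type, Sum.elim_inl, Sum.elim_inr, map_zero, sub_zero]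
    exact Submodule.add_mem _ (sum_jetPoly_mem_depSpan A B c a h)
      (Submodule.sum_mem _ fun μ _ => jetPoly_B_mem_depSpan A B c μ a _)
  by_cases h1 : p = -1
  · subst h1
    obtain ⟨P, rfl⟩ := gaussian_eq_sum m (Sum.elim ΩA ΩB)
      (by rintro (_ | _ | _ | _ | _ | _) hf <;> simp_all [GaussField.gh]) hv
    have hB (k) := congrArg (coord (B k) a) hcl
    have hA (k) := congrArg (coord (A k) a) hcl
    obtain ⟨⟨t, ht⟩, hy⟩ := exists_of_source_closed m (x := P ∘ Sum.inl) (y := P ∘ Sum.inr)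
      (fun k => by
        rw [← map_zero (coord (B k) a), ← hB k]
        fin_cases k <;> simp [Fin.sum_univ_three, gaussian_linOp_ΩA, gaussian_linOp_ΩB,
          coord_jetPoly, symbolCurl, smul_eq_C_mul, C_two] <;> ring)
      (fun k => by
        rw [← map_zero (coord (A k) a), ← hA k]
        fin_cases k <;> simp [Fin.sum_univ_three, gaussian_linOp_ΩA, gaussian_linOp_ΩB,
          coord_jetPoly, symbolCurl, smul_eq_C_mul] <;> ring)
    -- The `ΩB` part vanishes and the `ΩA` part is a gradient, which is exactly the image of `Ωc`.
    refine ⟨jetPoly Ωc a t, gaussian_jetPoly_mem m rfl a _, ?_⟩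
    simp only [Function.comp_apply] at ht hy
    simp [gaussian_linOp_Ωc, ht, hy]
  by_cases h2 : p = -2
  · subst h2
    obtain ⟨P, rfl⟩ := gaussian_eq_sum m (fun _ : Unit => Ωc)
      (by rintro (_ | _ | _ | _ | _ | _) hf <;> simp_all [GaussField.gh]) hv
    refine ⟨0, Submodule.zero_mem _, ?_⟩
    have h := congrArg (coord (ΩA 0) a) hcl
    simp [gaussian_linOp_Ωc, coord_jetPoly] at h
    simp [h]
  · obtain ⟨P, rfl⟩ := gaussian_eq_sum m (Empty.elim : Empty → GaussField)
      (by rintro (_ | _ | _ | _ | _ | _) hf <;> simp_all [GaussField.gh]) hv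
    exact ⟨0, Submodule.zero_mem _, by simp⟩

/-- Only here are all generators closed: in the extended model `B` maps to `-dφ`. -/
theorem gaussian_b₀_depAlg {P : (gaussian ι m).Alg} (hP : P ∈ depAlg (gaussian ι m) A B c) :
    (gaussian ι m).b₀ P = 0 := by
  induction hP using Algebra.adjoin_induction with
  | mem P h =>
    rcases h with (⟨μ, ν, a, α, rfl⟩ | ⟨a, rfl⟩) | ⟨μ, a, α, rfl⟩
    · rw [LinearModel.b₀_lin, extd, map_sub, gaussian_linOp_jet, gaussian_linOp_jet]
      simp [GaussField.op, up_comm]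
    · rw [LinearModel.b₀_gen, show (gaussian ι m).op (c, a, 0) = 0 from rfl, map_zero]
    · rw [LinearModel.b₀_gen, show (gaussian ι m).op (B μ, a, α) = 0 from rfl, map_zero]
  | algebraMap r => exact (gaussian ι m).b₀_algebraMap r
  | add _ _ _ _ h h' => rw [map_add, h, h', add_zero]
  | mul _ _ _ _ h h' => rw [LinearModel.b₀_mul, h, h', zero_mul, mul_zero, add_zero]

end Gaussian

/-! ### Linear cohomology of the extended model -/

section Extended

open ExtField

variable {ι : Type*} (m : ℂ)

theorem extended_linOp_jet (f : ExtField) (a : ι) (α : Fin 3 →₀ ℕ) :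
    (extended ι m).linOp (jet f a α) = ExtField.op m (f, a, α) := by
  simp [LinearModel.linOp, jet, extended]

theorem extended_linOp_A (μ : Fin 3) (a : ι) (P : MvPolynomial (Fin 3) ℂ) :
    (extended ι m).linOp (jetPoly (A μ) a P) = -jetPoly c a (X μ * P) :=
  ext_monomial (g := (extended ι m).linOp ∘ₗ jetPoly (A μ) a)
    (g' := -(jetPoly c a ∘ₗ LinearMap.mulLeft ℂ (X μ)))
    (fun α => by simp [extended_linOp_jet, jetPoly_X_mul_monomial, ExtField.op]) P

theorem extended_linOp_B (μ : Fin 3) (a : ι) (P : MvPolynomial (Fin 3) ℂ) :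
    (extended ι m).linOp (jetPoly (B μ) a P) = -jetPoly φ a (X μ * P) :=
  ext_monomial (g := (extended ι m).linOp ∘ₗ jetPoly (B μ) a)
    (g' := -(jetPoly φ a ∘ₗ LinearMap.mulLeft ℂ (X μ)))
    (fun α => by simp [extended_linOp_jet, jetPoly_X_mul_monomial, ExtField.op]) P

theorem extended_linOp_η (a : ι) (P : MvPolynomial (Fin 3) ℂ) :
    (extended ι m).linOp (jetPoly η a P) = jetPoly φ a P :=
  ext_monomial (g := (extended ι m).linOp ∘ₗ jetPoly η a) (g' := jetPoly φ a)
    (fun α => by simp [extended_linOp_jet, ExtField.op]) P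

theorem extended_linOp_ΩA (μ : Fin 3) (a : ι) (P : MvPolynomial (Fin 3) ℂ) :
    (extended ι m).linOp (jetPoly (ΩA μ) a P) =
      Complex.I • starDPoly B μ a P + (Complex.I * m) • starDPoly A μ a P :=
  ext_monomial (g := (extended ι m).linOp ∘ₗ jetPoly (ΩA μ) a)
    (g' := Complex.I • starDPoly B μ a + (Complex.I * m) • starDPoly A μ a)
    (fun α => by simp [-starDPoly_apply, starDPoly_monomial, extended_linOp_jet, ExtField.op]) P

theorem extended_linOp_ΩB (μ : Fin 3) (a : ι) (P : MvPolynomial (Fin 3) ℂ) :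
    (extended ι m).linOp (jetPoly (ΩB μ) a P) = Complex.I • starDPoly A μ a P +
      (2 : ℂ) • (jetPoly (B μ) a P + jetPoly η a (X μ * P)) :=
  ext_monomial (g := (extended ι m).linOp ∘ₗ jetPoly (ΩB μ) a)
    (g' := Complex.I • starDPoly A μ a +
      (2 : ℂ) • (jetPoly (B μ) a + jetPoly η a ∘ₗ LinearMap.mulLeft ℂ (X μ)))
    (fun α => by simp [-starDPoly_apply, starDPoly_monomial, extended_linOp_jet,
      jetPoly_X_mul_monomial, ExtField.op]) P

theorem extended_linOp_Ωη (a : ι) (P : MvPolynomial (Fin 3) ℂ) :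
    (extended ι m).linOp (jetPoly Ωη a P) =
      (-2 : ℂ) • ∑ μ, (jetPoly (B μ) a (X μ * P) + jetPoly η a (X μ * (X μ * P))) :=
  (ext_monomial (g := (extended ι m).linOp ∘ₗ jetPoly Ωη a)
    (g' := (-2 : ℂ) • ∑ μ, (jetPoly (B μ) a ∘ₗ LinearMap.mulLeft ℂ (X μ) +
      jetPoly η a ∘ₗ LinearMap.mulLeft ℂ (X μ) ∘ₗ LinearMap.mulLeft ℂ (X μ)))
    (fun α => by
      simp [extended_linOp_jet, X_mul_monomial, ExtField.op, dDag, Finset.sum_add_distrib]) P).trans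
    (by simp)

theorem extended_linOp_Ωc (a : ι) (P : MvPolynomial (Fin 3) ℂ) :
    (extended ι m).linOp (jetPoly Ωc a P) = -∑ μ, jetPoly (ΩA μ) a (X μ * P) :=
  (ext_monomial (g := (extended ι m).linOp ∘ₗ jetPoly Ωc a)
    (g' := -∑ μ, jetPoly (ΩA μ) a ∘ₗ LinearMap.mulLeft ℂ (X μ))
    (fun α => by simp [extended_linOp_jet, jetPoly_X_mul_monomial, ExtField.op, dDag]) P).trans
    (by simp)

theorem extended_linOp_Ωφ (a : ι) (P : MvPolynomial (Fin 3) ℂ) :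
    (extended ι m).linOp (jetPoly Ωφ a P) =
      -∑ μ, jetPoly (ΩB μ) a (X μ * P) - jetPoly Ωη a P :=
  (ext_monomial (g := (extended ι m).linOp ∘ₗ jetPoly Ωφ a)
    (g' := -∑ μ, jetPoly (ΩB μ) a ∘ₗ LinearMap.mulLeft ℂ (X μ) - jetPoly Ωη a)
    (fun α => by simp [extended_linOp_jet, jetPoly_X_mul_monomial, ExtField.op, dDag]) P).trans
    (by simp)

theorem extended_op_mem_index (x : Jet ExtField ι) :
    (extended ι m).op x ∈ Finsupp.supported ℂ ℂ {y : Jet ExtField ι | y.2.1 = x.2.1} := by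
  obtain ⟨_ | _ | _ | _ | _ | _ | _ | _ | _ | _, a, α⟩ := x
  · exact Submodule.neg_mem _ (jet_mem rfl)
  · exact Submodule.neg_mem _ (jet_mem rfl)
  · exact jet_mem rfl
  · exact Submodule.zero_mem _
  · exact Submodule.zero_mem _
  · exact Submodule.add_mem _ (Submodule.smul_mem _ _ (extd_mem_index _ _ _ _ _))
      (Submodule.smul_mem _ _ (extd_mem_index _ _ _ _ _))
  · exact Submodule.add_mem _ (Submodule.smul_mem _ _ (extd_mem_index _ _ _ _ _))
      (Submodule.smul_mem _ _ (Submodule.add_mem _ (jet_mem rfl) (jet_mem rfl)))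
  · exact Submodule.smul_mem _ _ (Submodule.add_mem _ (dDag_mem (fun _ _ => rfl) _)
      (Submodule.sum_mem _ fun _ _ => jet_mem rfl))
  · exact Submodule.neg_mem _ (dDag_mem (fun _ _ => rfl) _)
  · exact Submodule.sub_mem _ (Submodule.neg_mem _ (dDag_mem (fun _ _ => rfl) _)) (jet_mem rfl)

theorem extended_jetPoly_mem {p : ℤ} {f : ExtField} (hf : f.gh = p) (a : ι)
    (P : MvPolynomial (Fin 3) ℂ) : jetPoly f a P ∈ (extended ι m).linPart p :=
  jetPoly_mem (fun _ => hf) P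

/-- The elements of ghost number `p` are combinations of a family exhausting the fields of ghost
number `p`. -/
theorem extended_eq_sum {κ : Type*} [Fintype κ] (e : κ → ExtField) {p : ℤ}
    (he : ∀ f : ExtField, f.gh = p → f ∈ Set.range e) {a : ι} {v : Jet ExtField ι →₀ ℂ}
    (hv : v ∈ Finsupp.supported ℂ ℂ {x | (extended ι m).gh x = p ∧ x.2.1 = a}) :
    ∃ P : κ → MvPolynomial (Fin 3) ℂ, v = ∑ k, jetPoly (e k) a (P k) :=
  have h : {x : Jet ExtField ι | (extended ι m).gh x = p ∧ x.2.1 = a} ⊆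
      {x | x.1 ∈ Set.range e ∧ x.2.1 = a} := fun x hx => ⟨he x.1 hx.1, hx.2⟩
  exists_eq_sum_jetPoly e a (Finsupp.supported_mono h hv)

/-- The extra variables cancel: `φ` is the image of `η`, `B + dη` is exact modulo `dA` through `ΩB`,
and `Ωη` is removed by `Ωφ`. The representatives found here involve only `dA` and constant
coefficients of `c`. -/
theorem extended_linear_cohomology (p : ℤ) {v : Jet ExtField ι →₀ ℂ}
    (hv : v ∈ (extended ι m).linPart p) (hcl : (extended ι m).linOp v = 0) :
    ∃ u ∈ (extended ι m).linPart (p - 1), v - (extended ι m).linOp u ∈ depSpan A B c := by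
  refine LinearModel.linear_cohomology_of_index _ (extended_op_mem_index m) _ p
    (fun a v hv hcl => ?_) hv hcl
  by_cases h1 : p = 1
  · subst h1
    obtain ⟨P, rfl⟩ := extended_eq_sum m (Sum.elim (fun _ : Unit => c) fun _ : Unit => φ)
      (by rintro (_ | _ | _ | _ | _ | _ | _ | _ | _ | _) hf <;> simp_all [ExtField.gh]) hv
    obtain ⟨r, Q, hQ⟩ := exists_eq_C_add_sum (P (Sum.inl ()))
    refine ⟨jetPoly η a (P (Sum.inr ())) - ∑ μ, jetPoly (A μ) a (Q μ), Submodule.sub_mem _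
      (extended_jetPoly_mem m rfl a _) (Submodule.sum_mem _ fun μ _ =>
        extended_jetPoly_mem m rfl a _), ?_⟩
    simpa [hQ, extended_linOp_A, extended_linOp_η, add_sub_add_comm] using
      jetPoly_c_mem_depSpan A B c a r
  by_cases h0 : p = 0
  · subst h0
    obtain ⟨P, rfl⟩ := extended_eq_sum m (Sum.elim (Sum.elim A B) fun _ : Unit => η)
      (by rintro (_ | _ | _ | _ | _ | _ | _ | _ | _ | _) hf <;> simp_all [ExtField.gh]) hv
    have hc := congrArg (coord c a) hcl
    have hφ := congrArg (coord φ a) hcl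
    simp [extended_linOp_A, extended_linOp_B, extended_linOp_η, coord_jetPoly] at hc hφ
    -- The factor `1 / 2` matches `2 (B + dη)` in the image of `ΩB`. Closure forces the `η`
    -- coefficient to be the divergence of the `B` coefficients, so `B` and `η` disappear together.
    refine ⟨(1 / 2 : ℂ) • ∑ μ, jetPoly (ΩB μ) a (P (Sum.inl (Sum.inr μ))), Submodule.smul_mem _ _
      (Submodule.sum_mem _ fun μ _ => extended_jetPoly_mem m rfl a _), ?_⟩
    have hη : P (Sum.inr ()) = ∑ μ, X μ * P (Sum.inl (Sum.inr μ)) := by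
      linear_combination hφ
    have H := Submodule.sub_mem _ (sum_jetPoly_mem_depSpan A B c a hc)
      (Submodule.smul_mem _ (Complex.I / 2) (Submodule.sum_mem (t := Finset.univ) _ fun μ _ =>
        jetPoly_curl_mem_depSpan A B c (μ + 1) (μ + 2) a (P (Sum.inl (Sum.inr μ)))))
    convert H using 1
    simp only [Fintype.sum_sum_type, Sum.elim_inl, Sum.elim_inr, Finset.univ_unique,
      Finset.sum_singleton, PUnit.default_eq_unit, hη, map_smul, map_sum, extended_linOp_ΩB,
      starDPoly_apply, Finset.sum_add_distrib, ← Finset.smul_sum]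
    module
  by_cases h1 : p = -1
  · subst h1
    obtain ⟨P, rfl⟩ := extended_eq_sum m (Sum.elim (Sum.elim ΩA ΩB) fun _ : Unit => Ωη)
      (by rintro (_ | _ | _ | _ | _ | _ | _ | _ | _ | _) hf <;> simp_all [ExtField.gh]) hv
    have hB (k) := congrArg (coord (B k) a) hcl
    have hA (k) := congrArg (coord (A k) a) hcl
    -- Modulo the image of `Ωφ`, `Ωη` equals `-d† ΩB`, which shifts the `ΩB` coefficients by a
    -- gradient. After this shift the system is that of the gaussian model; the gradient has no curl
    -- and so leaves the `A` equations unchanged.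
    obtain ⟨⟨t, ht⟩, hy⟩ := exists_of_source_closed m (x := fun μ => P (Sum.inl (Sum.inl μ)))
      (y := fun μ => P (Sum.inl (Sum.inr μ)) - X μ * P (Sum.inr ()))
      (fun k => by
        rw [← map_zero (coord (B k) a), ← hB k]
        fin_cases k <;> simp [Fin.sum_univ_three, extended_linOp_ΩA, extended_linOp_ΩB,
          extended_linOp_Ωη, coord_jetPoly, symbolCurl, smul_eq_C_mul, C_two] <;> ring)
      (fun k => by
        rw [← map_zero (coord (A k) a), ← hA k]
        fin_cases k <;> simp [Fin.sum_univ_three, extended_linOp_ΩA, extended_linOp_ΩB,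
          extended_linOp_Ωη, coord_jetPoly, symbolCurl, smul_eq_C_mul] <;> ring)
    refine ⟨-jetPoly Ωc a t - jetPoly Ωφ a (P (Sum.inr ())), Submodule.sub_mem _
      (Submodule.neg_mem _ (extended_jetPoly_mem m rfl a _)) (extended_jetPoly_mem m rfl a _), ?_⟩
    simp only [sub_eq_zero] at ht hy
    convert Submodule.zero_mem _ using 1
    simp only [Fintype.sum_sum_type, Sum.elim_inl, Sum.elim_inr, Finset.univ_unique,
      Finset.sum_singleton, PUnit.default_eq_unit, map_sub, map_neg, extended_linOp_Ωc,
      extended_linOp_Ωφ, ht, hy]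
    abel
  by_cases h2 : p = -2
  · subst h2
    obtain ⟨P, rfl⟩ := extended_eq_sum m (Sum.elim (fun _ : Unit => Ωc) fun _ : Unit => Ωφ)
      (by rintro (_ | _ | _ | _ | _ | _ | _ | _ | _ | _) hf <;> simp_all [ExtField.gh]) hv
    refine ⟨0, Submodule.zero_mem _, ?_⟩
    -- The coefficient of `Ωη` comes from `Ωφ` alone and kills that part; the coefficient of `ΩA 0`
    -- kills the `Ωc` part.
    have hη := congrArg (coord Ωη a) hcl
    have hA := congrArg (coord (ΩA 0) a) hcl
    simp [extended_linOp_Ωc, extended_linOp_Ωφ, coord_jetPoly] at hη hA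
    simp [hη, hA]
  · obtain ⟨P, rfl⟩ := extended_eq_sum m (Empty.elim : Empty → ExtField)
      (by rintro (_ | _ | _ | _ | _ | _ | _ | _ | _ | _) hf <;> simp_all [ExtField.gh]) hv
    exact ⟨0, Submodule.zero_mem _, by simp⟩

end Extended

end BFYM

/-! ### Conclusion for both models -/

theorem proposition3p1 (ι : Type*) (m : ℂ) :
    ((∀ P ∈ BFYM.depAlg (BFYM.gaussian ι m) BFYM.GaussField.A BFYM.GaussField.B BFYM.GaussField.c,
        (BFYM.gaussian ι m).b₀ P = 0) ∧
      ∀ (p : ℤ) (q : ℕ) (h : (BFYM.gaussian ι m).Cohomology p q),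
        ∃ ω : (BFYM.gaussian ι m).cocycles p q,
          (∀ I, ω.1 I ∈ BFYM.depAlg (BFYM.gaussian ι m)
            BFYM.GaussField.A BFYM.GaussField.B BFYM.GaussField.c) ∧
          (BFYM.gaussian ι m).cls ω = h) ∧
    ∀ (p : ℤ) (q : ℕ) (h : (BFYM.extended ι m).Cohomology p q),
      ∃ ω : (BFYM.extended ι m).cocycles p q,
        (∀ I, ω.1 I ∈ BFYM.depAlg (BFYM.extended ι m)
          BFYM.ExtField.A BFYM.ExtField.B BFYM.ExtField.c) ∧
        (BFYM.extended ι m).cls ω = h := by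
  refine ⟨⟨fun P hP => BFYM.gaussian_b₀_depAlg m hP, ?_⟩, ?_⟩
  · exact BFYM.LinearModel.exists_cohomologous _ _
      (fun p _ hv hcl => BFYM.gaussian_linear_cohomology m p hv hcl) _
      fun _ hv => BFYM.lin_mem_depAlg _ _ _ _ hv
  · exact BFYM.LinearModel.exists_cohomologous _ _
      (fun p _ hv hcl => BFYM.extended_linear_cohomology m p hv hcl) _
      fun _ hv => BFYM.lin_mem_depAlg _ _ _ _ hv
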